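/- **Setting.** Let $\mathcal B$ be a (not necessarily unital) Boolean algebra with least element $\emptyset$, let $\mathcal L$ be a set, let $\theta_a:\mathcal B\to\mathcal B$ ($a\in\mathcal L$) be Boolean homomorphisms with $\theta_a(\emptyset)=\emptyset$, and let $\mathcal I_a\subseteq\mathcal B$ ($a\in\mathcal L$) be ideals with $\{A: A\subseteq\theta_a(C)\text{ for some }C\in\mathcal B\}\subseteq\mathcal I_a$; that is, $(\mathcal B,\mathcal L,\theta,\mathcal I_\alpha)$ is a generalized Boolean dynamical system. For a finite word $\alpha=\alpha_1\cdots\alpha_n$ put $\theta_\alpha=\theta_{\alpha_n}\circ\cdots\circ\theta_{\alpha_1}$ and, if $n\ge 1$, $\mathcal I_\alpha=\{A: A\subseteq\theta_{\alpha_2\cdots\alpha_n}(C)\text{ for some }C\in\mathcal I_{\alpha_1}\}$; put $\theta_\emptyset=\mathrm{id}$ and $\mathcal I_\emptyset=\mathcal B$. Let $\mathcal W^{\le\infty}$ be the set of finite words $\alpha$ with $\mathcal I_\alpha\ne\{\emptyset\}$ and infinite words $\alpha$ with $\mathcal I_{\alpha_{1,n}}\neq\{\emptyset\}$ for all $n\ge1$,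 where $\alpha_{1,n}$ is the initial segment of length $n$. **The inverse semigroup.** Let $S=\{(\alpha,A,\beta):\alpha,\beta\text{ finite words},\ \emptyset\ne A\in\mathcal I_\alpha\cap\mathcal I_\beta\}\cup\{0\}$, with $(\alpha,A,\beta)^*=(\beta,A,\alpha)$ and with $$(\alpha,A,\beta)(\gamma,C,\delta)=\begin{cases}(\alpha\gamma',\theta_{\gamma'}(A)\cap C,\delta)&\text{if }\gamma=\beta\gamma',\\(\alpha,A\cap\theta_{\beta'}(C),\delta\beta')&\text{if }\beta=\gamma\beta',\\0&\text{otherwise,}\end{cases}$$ where the product is $0$ if the middle entry is $\emptyset$. Then $S$ is an inverse semigroup with zero; let $E$ be its semilattice of idempotents. **The tight groupoid.** A character of $E$ is a nonzero map $\phi:E\to\{0,1\}$ with $\phi(0)=0$ and $\phi(ef)=\phi(e)\phi(f)$. It is tight if $\bigvee_{z\in Z}\phi(z)=\phi(x)$ for every $x\in E$ and every finite $Z\subseteq\{y\in E:y\le x\}$ such that each nonzero $y\le x$ has $zy\neq0$ for some $z\in Z$. A filter $\xi\subseteq E$ is tight if its indicator function is a tight character; $\mathsf T$ is the set of tight filters.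 The tight groupoid $\mathcal G_{tight}(S)$ is the set of germs $[s,\phi]$ with $s\in S$ and $\phi$ a tight character with $\phi(s^*s)=1$, where $[s,\phi]=[t,\psi]$ iff $\phi=\psi$ and $se=te$ for some $e\in E$ with $\phi(e)=1$. With $\rho_s(\phi)(e)=\phi(s^*es)$, the germs $[s,\phi]$ and $[t,\psi]$ are composable iff $\phi=\rho_t(\psi)$; then $[s,\phi][t,\psi]=[st,\psi]$, and $[s,\phi]^{-1}=[s^*,\rho_s(\phi)]$. **Cutting and gluing.** The word associated with a filter $\xi\subseteq E$ is the shortest $\alpha\in\mathcal W^{\le\infty}$ such that $\beta$ is a beginning of $\alpha$ for every $(\beta,A,\beta)\in\xi$; we write $\xi=\xi^\alpha$ and $\xi_n=\{A:(\alpha_{1,n},A,\alpha_{1,n})\in\xi\}$ for $0\le n\le|\alpha|$ (with $n<\infty$). The filter associated with a word $\gamma$ and a family $(\mathcal F_n)_{0\le n\le|\gamma|}$, $\mathcal F_n\subseteq \mathcal I_{\gamma_{1,n}}$, is the set of all $p\in E$ with $p\ge(\gamma_{1,n},A,\gamma_{1,n})$ for some $n$ and some $A\in\mathcal F_n$. Let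 $\mathsf T_\alpha$ be the set of tight filters with associated word $\alpha$. Let $\alpha$ be a finite word. * If $\alpha\ne\emptyset$, then $H_{[\alpha]\gamma}(\xi)$, for $\xi\in\mathsf T_{\alpha\gamma}$, is the filter associated with $\gamma$ and the family $\{A\in\mathcal I_{\gamma_{1,n}}: C\subseteq A\text{ for some }C\in\xi_{|\alpha|+n}\}$. Moreover $H_{[\emptyset]\gamma}$ is the identity of $\mathsf T_\gamma$. * Let $\mathsf T_{(\emptyset)\gamma}=\mathsf T_\gamma$ and $\mathsf T_{(\alpha)\gamma}=\{\xi\in\mathsf T_\gamma:\xi_0\cap\mathcal I_\alpha\ne\emptyset\}$ for $\alpha\ne\emptyset$. If $\alpha\neq\emptyset$, then $G_{(\alpha)\gamma}(\xi)$, for $\xi\in\mathsf T_{(\alpha)\gamma}$, is the filter associated with $\alpha\gamma$ and the family $(\mathcal J_i)$ defined as follows: let $N=|\alpha|$ if $\gamma=\emptyset$ and $N=|\alpha|+1$ otherwise; $\mathcal J_i=\xi_{i-|\alpha|}\cap\mathcal I_{(\alpha\gamma)_{1,i}}$ for $i\ge N$, and, recursively downwards, $\mathcal J_i=\{A\in\mathcal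 I_{(\alpha\gamma)_{1,i}}:\theta_{(\alpha\gamma)_{i+1}}(A)\in\mathcal J_{i+1}\}$ for $i<N$. Moreover $G_{(\emptyset)\gamma}$ is the identity of $\mathsf T_\gamma$. **The groupoid $\Gamma$.** Let $$\Gamma=\Gamma(\mathcal B,\mathcal L,\theta,\mathcal I_\alpha)=\{(\eta^{\alpha\gamma},|\alpha|-|\beta|,\xi^{\beta\gamma})\in\mathsf T\times\mathbb Z\times\mathsf T: H_{[\alpha]\gamma}(\eta^{\alpha\gamma})=H_{[\beta]\gamma}(\xi^{\beta\gamma})\},$$ where $\alpha,\beta$ range over the finite words and $\gamma$ over the finite and infinite words, with $(\eta,m,\xi)(\xi,n,\rho)=(\eta,m+n,\rho)$ and $(\eta,m,\xi)^{-1}=(\xi,-m,\eta)$. **Theorem.** There is a well-defined map $\Phi:\mathcal G_{tight}(S)\to\Gamma$ given by $$[t,\phi]\mapsto\big((G_{(\beta)\alpha'}\circ H_{[\gamma]\alpha'})(\xi^\alpha),\ |\beta|-|\gamma|,\ \xi^\alpha\big),$$ where $t=(\beta,A,\gamma)\in S$, $\phi(t^*t)=1$, $\xi^\alpha=\{e\in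 E:\phi(e)=1\}$ is the filter associated with $\phi$, and $\alpha=\gamma\alpha'$ for some $\alpha'\in\mathcal W^{\le\infty}$ (which exists since $(\gamma,A,\gamma)\in\xi^\alpha$); in particular $H_{[\gamma]\alpha'}(\xi^\alpha)\in\mathsf T_{(\gamma)\alpha'}\cap\mathsf T_{(\beta)\alpha'}$ and $(G_{(\beta)\alpha'}\circ H_{[\gamma]\alpha'})(\xi^\alpha)\in\mathsf T_{\beta\alpha'}$. The map $\Phi$ is an isomorphism of groupoids. -/

import Mathlib

universe u v

/-! ### Groupoids as sets with a partially defined product -/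

/-- A groupoid, given as a set `G` with a set of composable pairs, a product defined on composable
pairs, and an inversion. -/
class SetGroupoid (G : Type u) where
  /-- The set of composable pairs. -/
  Composable : G → G → Prop
  comp : ∀ x y : G, Composable x y → G
  inv : G → G
  inv_inv : ∀ x, inv (inv x) = x
  composable_comp_left : ∀ x y z (hxy : Composable x y) (_ : Composable y z),
    Composable (comp x y hxy) z
  composable_comp_right : ∀ x y z (_ : Composable x y) (hyz : Composable y z),
    Composable x (comp y z hyz)
  assoc : ∀ x y z (hxy : Composable x y) (hyz : Composable y z),
    comp (comp x y hxy) z (composable_comp_left x y z hxy hyz) =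
      comp x (comp y z hyz) (composable_comp_right x y z hxy hyz)
  composable_inv_left : ∀ x, Composable (inv x) x
  composable_inv_right : ∀ x, Composable x (inv x)
  inv_comp_cancel : ∀ x y (hxy : Composable x y),
    comp (inv x) (comp x y hxy)
      (composable_comp_right (inv x) x y (composable_inv_left x) hxy) = y
  comp_inv_cancel : ∀ x y (hxy : Composable x y),
    comp (comp x y hxy) (inv y)
      (composable_comp_left x y (inv y) hxy (composable_inv_right y)) = x

/-- An isomorphism of groupoids: a bijection that preserves and reflects composability, and
preserves products and inverses. -/
structure IsGroupoidIso {G : Type u} {H : Type v} [SetGroupoid G] [SetGroupoid H]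
    (F : G → H) : Prop where
  bijective : Function.Bijective F
  composable_iff : ∀ x y, SetGroupoid.Composable x y ↔ SetGroupoid.Composable (F x) (F y)
  map_comp : ∀ x y (h : SetGroupoid.Composable x y),
    F (SetGroupoid.comp x y h) = SetGroupoid.comp (F x) (F y) ((composable_iff x y).1 h)
  map_inv : ∀ x, F (SetGroupoid.inv x) = SetGroupoid.inv (F x)

/-! ### Filters -/

/-- Filters in a partially ordered set with least element. -/
structure IsPosetFilter {P : Type u} [PartialOrder P] [OrderBot P] (ξ : Set P) : Prop where
  nonempty : ξ.Nonempty
  bot_notMem : (⊥ : P) ∉ ξ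
  up : ∀ x y, x ∈ ξ → x ≤ y → y ∈ ξ
  directed : ∀ x y, x ∈ ξ → y ∈ ξ → ∃ z ∈ ξ, z ≤ x ∧ z ≤ y

/-! ### Inverse semigroups with zero -/

/-- An inverse semigroup with zero: a regular semigroup with zero whose idempotents commute;
`star s` is the inverse of `s`. -/
class InverseSemigroupWithZero (S : Type u) extends SemigroupWithZero S, Star S where
  mul_star_mul_self : ∀ s : S, s * star s * s = s
  star_mul_self_mul_star : ∀ s : S, star s * s * star s = star s
  idem_comm : ∀ e f : S, e * e = e → f * f = f → e * f = f * e

namespace InverseSemigroupWithZero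

variable {S : Type u} [InverseSemigroupWithZero S]

theorem star_mul_idem (s : S) : (star s * s) * (star s * s) = star s * s := by
  rw [← mul_assoc, star_mul_self_mul_star]

theorem mul_star_idem (s : S) : (s * star s) * (s * star s) = s * star s := by
  rw [← mul_assoc, mul_star_mul_self]

theorem mul_idem {e f : S} (he : e * e = e) (hf : f * f = f) : (e * f) * (e * f) = e * f := by
  calc (e * f) * (e * f) = e * (f * e) * f := by simp only [mul_assoc]
    _ = e * (e * f) * f := by rw [idem_comm f e hf he]
    _ = (e * e) * (f * f) := by simp only [mul_assoc]
    _ = e * f := by rw [he, hf]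

theorem eq_star {s t : S} (h1 : s * t * s = s) (h2 : t * s * t = t) : t = star s := by
  have hts : (t * s) * (t * s) = t * s := by rw [← mul_assoc, h2]
  have hst : (s * t) * (s * t) = s * t := by rw [← mul_assoc, h1]
  calc t = t * s * t := h2.symm
    _ = t * (s * star s * s) * t := by rw [mul_star_mul_self]
    _ = t * ((s * star s) * (s * t)) := by simp only [mul_assoc]
    _ = t * ((s * t) * (s * star s)) := by rw [idem_comm _ _ (mul_star_idem s) hst]
    _ = (t * s * t) * (s * star s) := by simp only [mul_assoc]
    _ = t * s * star s := by rw [h2]; simp only [mul_assoc]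
    _ = t * s * (star s * s * star s) := by rw [star_mul_self_mul_star]
    _ = ((t * s) * (star s * s)) * star s := by simp only [mul_assoc]
    _ = ((star s * s) * (t * s)) * star s := by rw [idem_comm _ _ (star_mul_idem s) hts]
    _ = star s * (s * t * s) * star s := by simp only [mul_assoc]
    _ = star s := by rw [h1, star_mul_self_mul_star]

theorem star_invol (s : S) : star (star s) = s :=
  (eq_star (star_mul_self_mul_star s) (mul_star_mul_self s)).symm

theorem star_idem {e : S} (he : e * e = e) : star e = e :=
  (eq_star (by rw [he, he]) (by rw [he, he])).symm

theorem star_of_mul (s t : S) : star (s * t) = star t * star s := by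
  symm
  apply eq_star
  · calc s * t * (star t * star s) * (s * t) = s * ((t * star t) * (star s * s)) * t := by
          simp only [mul_assoc]
      _ = s * ((star s * s) * (t * star t)) * t := by
          rw [idem_comm _ _ (mul_star_idem t) (star_mul_idem s)]
      _ = (s * star s * s) * (t * star t * t) := by simp only [mul_assoc]
      _ = s * t := by rw [mul_star_mul_self, mul_star_mul_self]
  · calc star t * star s * (s * t) * (star t * star s)
        = star t * ((star s * s) * (t * star t)) * star s := by simp only [mul_assoc]
      _ = star t * ((t * star t) * (star s * s)) * star s := by
          rw [idem_comm _ _ (mul_star_idem t) (star_mul_idem s)]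
      _ = (star t * t * star t) * (star s * s * star s) := by simp only [mul_assoc]
      _ = star t * star s := by rw [star_mul_self_mul_star, star_mul_self_mul_star]

theorem conj_idem (s : S) {e : S} (he : e * e = e) :
    (star s * e * s) * (star s * e * s) = star s * e * s := by
  calc (star s * e * s) * (star s * e * s) = star s * (e * (s * star s)) * (e * s) := by
        simp only [mul_assoc]
    _ = star s * ((s * star s) * e) * (e * s) := by rw [idem_comm _ _ he (mul_star_idem s)]
    _ = (star s * s * star s) * (e * e) * s := by simp only [mul_assoc]
    _ = star s * e * s := by rw [he, star_mul_self_mul_star]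

/-- An idempotent can be moved through `s`. -/
theorem idem_mul (s : S) {e : S} (he : e * e = e) : e * s = s * (star s * e * s) := by
  calc e * s = e * (s * star s) * s := by rw [mul_assoc, mul_star_mul_self]
    _ = (s * star s) * e * s := by rw [idem_comm _ _ he (mul_star_idem s)]
    _ = s * (star s * e * s) := by simp only [mul_assoc]

end InverseSemigroupWithZero

open InverseSemigroupWithZero

/-- The idempotents of `S`. -/
def Idem (S : Type u) [InverseSemigroupWithZero S] : Type u := {e : S // e * e = e}

namespace Idem

variable {S : Type u} [InverseSemigroupWithZero S]

/-- The idempotent semilattice: `e ≤ f` iff `e f = e`, and `e ⊓ f = e f`. -/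
instance : SemilatticeInf (Idem S) where
  le e f := e.1 * f.1 = e.1
  le_refl e := e.2
  le_trans e f g hef hfg := by
    rw [← hef, mul_assoc, hfg]
  le_antisymm e f hef hfe := by
    apply Subtype.ext
    rw [← hef, idem_comm _ _ e.2 f.2, hfe]
  inf e f := ⟨e.1 * f.1, mul_idem e.2 f.2⟩
  inf_le_left e f := by
    change e.1 * f.1 * e.1 = e.1 * f.1
    rw [idem_comm _ _ e.2 f.2, mul_assoc, e.2]
  inf_le_right e f := by
    change e.1 * f.1 * f.1 = e.1 * f.1
    rw [mul_assoc, f.2]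
  le_inf e f g hef heg := by
    change e.1 * (f.1 * g.1) = e.1
    rw [← mul_assoc, hef, heg]

instance : OrderBot (Idem S) where
  bot := ⟨0, zero_mul 0⟩
  bot_le e := zero_mul e.1

/-- `s⋆ s` as an element of `E`. -/
def dom (s : S) : Idem S := ⟨star s * s, star_mul_idem s⟩

/-- `s⋆ e s` as an element of `E`. -/
def conj (s : S) (e : Idem S) : Idem S := ⟨star s * e.1 * s, conj_idem s e.2⟩

/-- `Z` is a cover for `x` : a set of elements below `x` such that every nonzero element below `x`
intersects some element of `Z`. -/
def IsCover (Z : Finset (Idem S)) (x : Idem S) : Prop :=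
  (∀ z ∈ Z, z ≤ x) ∧ ∀ y ≤ x, y ≠ ⊥ → ∃ z ∈ Z, z ⊓ y ≠ ⊥

/-- Characters on `E`, with values in the Boolean algebra `{0, 1}`. -/
structure IsCharacter (φ : Idem S → Bool) : Prop where
  nonzero : ∃ e, φ e = true
  map_bot : φ ⊥ = false
  map_inf : ∀ e f, φ (e ⊓ f) = (φ e && φ f)

/-- Tight characters. -/
structure IsTightChar (φ : Idem S → Bool) : Prop extends IsCharacter φ where
  tight : ∀ (x : Idem S) (Z : Finset (Idem S)), IsCover Z x → Z.sup φ = φ x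

end Idem

open Idem

/-- The tight spectrum, as a set of characters. -/
def TightChar (S : Type u) [InverseSemigroupWithZero S] : Type u :=
  {φ : Idem S → Bool // IsTightChar φ}

open Classical in
/-- The character of a filter. -/
noncomputable def charOf {S : Type u} [InverseSemigroupWithZero S] (ξ : Set (Idem S)) :
    Idem S → Bool := fun e => decide (e ∈ ξ)

/-- Tight filters in `E`. -/
def IsTightFilter {S : Type u} [InverseSemigroupWithZero S] (ξ : Set (Idem S)) : Prop :=
  IsPosetFilter ξ ∧ IsTightChar (charOf ξ)

/-- The set `T` of tight filters in `E`. -/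
def TightFilter (S : Type u) [InverseSemigroupWithZero S] : Type u :=
  {ξ : Set (Idem S) // IsTightFilter ξ}

namespace TightChar

variable {S : Type u} [InverseSemigroupWithZero S]

theorem mono {φ : Idem S → Bool} (hφ : IsCharacter φ) {e f : Idem S} (h : e ≤ f)
    (he : φ e = true) : φ f = true := by
  have h1 := hφ.map_inf e f
  rw [inf_eq_left.2 h, he] at h1
  simpa using h1.symm

/-- The filter associated with a tight character. -/
def toFilter (φ : TightChar S) : TightFilter S :=
  ⟨{e | φ.1 e = true}, by
    refine ⟨⟨φ.2.nonzero, ?_, ?_, ?_⟩, ?_⟩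
    · have := φ.2.map_bot
      simp [this]
    · intro x y hx hxy
      exact mono φ.2.toIsCharacter hxy hx
    · intro x y hx hy
      refine ⟨x ⊓ y, ?_, inf_le_left, inf_le_right⟩
      have hx' : φ.1 x = true := hx
      have hy' : φ.1 y = true := hy
      simp [φ.2.map_inf, hx', hy']
    · have : charOf {e | φ.1 e = true} = φ.1 := by
        funext e
        simp [charOf]
      rw [this]
      exact φ.2⟩

theorem conj_mono (s : S) {e f : Idem S} (h : e ≤ f) : conj s e ≤ conj s f := by
  change (star s * e.1 * s) * (star s * f.1 * s) = star s * e.1 * s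
  have h' : e.1 * f.1 = e.1 := h
  calc (star s * e.1 * s) * (star s * f.1 * s)
      = star s * (e.1 * (s * star s)) * (f.1 * s) := by simp only [mul_assoc]
    _ = star s * ((s * star s) * e.1) * (f.1 * s) := by
        rw [idem_comm _ _ e.2 (mul_star_idem s)]
    _ = (star s * s * star s) * (e.1 * f.1) * s := by simp only [mul_assoc]
    _ = star s * e.1 * s := by rw [h', star_mul_self_mul_star]

theorem conj_inf (s : S) (e f : Idem S) : conj s (e ⊓ f) = conj s e ⊓ conj s f := by
  apply Subtype.ext
  change star s * (e.1 * f.1) * s = (star s * e.1 * s) * (star s * f.1 * s)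
  symm
  calc (star s * e.1 * s) * (star s * f.1 * s)
      = star s * (e.1 * (s * star s)) * (f.1 * s) := by simp only [mul_assoc]
    _ = star s * ((s * star s) * e.1) * (f.1 * s) := by
        rw [idem_comm _ _ e.2 (mul_star_idem s)]
    _ = (star s * s * star s) * (e.1 * f.1) * s := by simp only [mul_assoc]
    _ = star s * (e.1 * f.1) * s := by rw [star_mul_self_mul_star]

theorem conj_le_dom (s : S) (e : Idem S) : conj s e ≤ dom s := by
  change (star s * e.1 * s) * (star s * s) = star s * e.1 * s
  rw [mul_assoc, ← mul_assoc s, mul_star_mul_self]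

theorem conj_conj (s t : S) (e : Idem S) : conj t (conj s e) = conj (s * t) e := by
  apply Subtype.ext
  change star t * (star s * e.1 * s) * t = star (s * t) * e.1 * (s * t)
  rw [star_of_mul]
  simp only [mul_assoc]

theorem conj_cover (s : S) {Z : Finset (Idem S)} {x : Idem S} (h : IsCover Z x)
    (y : Idem S) (hy : y ≤ conj s x) (hy0 : y ≠ ⊥) : ∃ z ∈ Z, conj s z ⊓ y ≠ ⊥ := by
  have hyd : y.1 * (star s * s) = y.1 := le_trans hy (conj_le_dom s x)
  have hyd' : (star s * s) * y.1 = y.1 := by rw [idem_comm _ _ (star_mul_idem s) y.2, hyd]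
  -- transport `y` back along `s`
  have hback : conj s (conj (star s) y) = y := by
    apply Subtype.ext
    change star s * (star (star s) * y.1 * star s) * s = y.1
    rw [star_invol]
    calc star s * (s * y.1 * star s) * s = (star s * s) * y.1 * (star s * s) := by
          simp only [mul_assoc]
      _ = y.1 := by rw [hyd', hyd]
  have hle : conj (star s) y ≤ x := by
    refine le_trans (conj_mono (star s) hy) ?_
    change (star (star s) * (star s * x.1 * s) * star s) * x.1 =
      star (star s) * (star s * x.1 * s) * star s
    rw [star_invol]
    have h1 : s * (star s * x.1 * s) * star s = x.1 * (s * star s) := by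
      rw [← idem_mul s x.2, mul_assoc]
    rw [h1, mul_assoc, ← idem_comm _ _ x.2 (mul_star_idem s), ← mul_assoc, x.2]
  have hne : conj (star s) y ≠ ⊥ := by
    intro h0
    apply hy0
    rw [← hback, h0]
    apply Subtype.ext
    change star s * 0 * s = 0
    simp
  obtain ⟨z, hz, hzy⟩ := h.2 _ hle hne
  refine ⟨z, hz, fun h0 => hzy ?_⟩
  have h1 : (star s * z.1 * s) * y.1 = 0 := congrArg Subtype.val h0
  apply Subtype.ext
  change z.1 * (star (star s) * y.1 * star s) = 0
  rw [star_invol]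
  calc z.1 * (s * y.1 * star s) = (z.1 * s) * y.1 * star s := by simp only [mul_assoc]
    _ = s * ((star s * z.1 * s) * y.1) * star s := by
        rw [idem_mul s z.2]; simp only [mul_assoc]
    _ = 0 := by rw [h1]; simp

/-- The standard action: `ρ_s(φ)(e) = φ(s⋆ e s)` for `φ` with `φ(s⋆ s) = 1`. -/
def act (s : S) (φ : TightChar S) (h : φ.1 (dom s) = true) : TightChar S :=
  ⟨fun e => φ.1 (conj s e), by
    classical
    refine ⟨⟨⟨dom (star s), ?_⟩, ?_, ?_⟩, ?_⟩
    · have : conj s (dom (star s)) = dom s := by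
        apply Subtype.ext
        change star s * (star (star s) * star s) * s = star s * s
        rw [star_invol, ← mul_assoc, star_mul_self_mul_star]
      rw [this, h]
    · have : conj s ⊥ = ⊥ := by
        apply Subtype.ext
        change star s * 0 * s = 0
        simp
      rw [this, φ.2.map_bot]
    · intro e f
      rw [conj_inf, φ.2.map_inf]
    · intro x Z hZ
      have hc : IsCover (Z.image (conj s)) (conj s x) := by
        refine ⟨?_, ?_⟩
        · intro z hz
          obtain ⟨w, hw, rfl⟩ := Finset.mem_image.1 hz
          exact conj_mono s (hZ.1 w hw)
        · intro y hy hy0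
          obtain ⟨z, hz, hzy⟩ := conj_cover s hZ y hy hy0
          exact ⟨conj s z, Finset.mem_image_of_mem _ hz, hzy⟩
      have := φ.2.tight _ _ hc
      rw [Finset.sup_image] at this
      exact this⟩

theorem act_congr {s t : S} {φ : TightChar S} (hs : φ.1 (dom s) = true)
    (ht : φ.1 (dom t) = true) (e : Idem S) (he : φ.1 e = true) (h : s * e.1 = t * e.1) :
    act s φ hs = act t φ ht := by
  have key : ∀ (s : S) (x : Idem S), φ.1 (conj s x) = φ.1 (conj (s * e.1) x) := by
    intro s x
    have h1 : conj (s * e.1) x = e ⊓ (conj s x ⊓ e) := by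
      apply Subtype.ext
      change star (s * e.1) * x.1 * (s * e.1) = e.1 * ((star s * x.1 * s) * e.1)
      rw [star_of_mul, star_idem e.2]
      simp only [mul_assoc]
    rw [h1, φ.2.map_inf, φ.2.map_inf, he]
    simp
  apply Subtype.ext
  funext x
  change φ.1 (conj s x) = φ.1 (conj t x)
  rw [key s, key t, h]

end TightChar

/-! ### The tight groupoid of germs -/

/-- The set `Ω` of pairs `(s, φ)` with `φ(s⋆ s) = 1`. -/
structure GermPair (S : Type u) [InverseSemigroupWithZero S] where
  elt : S
  chr : TightChar S
  mem : chr.1 (dom elt) = true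

/-- `(s, φ) ~ (t, ψ)` iff `φ = ψ` and `s e = t e` for some idempotent `e` with `φ(e) = 1`. -/
instance germSetoid (S : Type u) [InverseSemigroupWithZero S] : Setoid (GermPair S) where
  r p q := p.chr = q.chr ∧ ∃ e : Idem S, p.chr.1 e = true ∧ p.elt * e.1 = q.elt * e.1
  iseqv :=
    { refl := fun p => ⟨rfl, dom p.elt, p.mem, rfl⟩
      symm := by
        rintro p q ⟨h, e, he, hpq⟩
        exact ⟨h.symm, e, h ▸ he, hpq.symm⟩
      trans := by
        rintro p q r ⟨h, e, he, hpq⟩ ⟨h', f, hf, hqr⟩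
        refine ⟨h.trans h', e ⊓ f, ?_, ?_⟩
        · rw [p.chr.2.map_inf, he, h, hf]; rfl
        · change p.elt * (e.1 * f.1) = r.elt * (e.1 * f.1)
          rw [← mul_assoc, hpq, mul_assoc, idem_comm _ _ e.2 f.2, ← mul_assoc, hqr, mul_assoc] }

/-- The set of germs. -/
def TightGroupoid (S : Type u) [InverseSemigroupWithZero S] : Type u := Quotient (germSetoid S)

namespace TightGroupoid

variable {S : Type u} [InverseSemigroupWithZero S]

/-- The germ `[s, φ]`. -/
def germ (s : S) (φ : TightChar S) (h : φ.1 (dom s) = true) : TightGroupoid S :=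
  Quotient.mk (germSetoid S) ⟨s, φ, h⟩

/-- `d([s, φ]) = φ`. -/
def source (g : TightGroupoid S) : TightChar S :=
  Quotient.lift GermPair.chr (by
    rintro p q ⟨h, _⟩
    exact h) g

/-- `r([s, φ]) = ρ_s(φ)`. -/
def range (g : TightGroupoid S) : TightChar S :=
  Quotient.lift (fun p : GermPair S => TightChar.act p.elt p.chr p.mem)
    (by
      rintro ⟨s, φ, hs⟩ ⟨t, ψ, ht⟩ ⟨h, e, he, hst⟩
      obtain rfl : φ = ψ := h
      exact TightChar.act_congr hs ht e he hst) g

theorem mul_mem {p q : GermPair S} (h : p.chr = TightChar.act q.elt q.chr q.mem) :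
    q.chr.1 (dom (p.elt * q.elt)) = true := by
  have h1 : dom (p.elt * q.elt) = conj q.elt (dom p.elt) := by
    apply Subtype.ext
    change star (p.elt * q.elt) * (p.elt * q.elt) = star q.elt * (star p.elt * p.elt) * q.elt
    rw [star_of_mul]
    simp only [mul_assoc]
  have h2 : p.chr.1 (dom p.elt) = q.chr.1 (conj q.elt (dom p.elt)) := by
    conv_lhs => rw [h]
    rfl
  rw [h1, ← h2, p.mem]

/-- The product on representatives: `(s, ρ_t(ψ)) (t, ψ) = (s t, ψ)`. -/
def mulPair (p q : GermPair S) (h : p.chr = TightChar.act q.elt q.chr q.mem) : GermPair S :=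
  ⟨p.elt * q.elt, q.chr, mul_mem h⟩

theorem mulPair_congr {p p' q q' : GermPair S} (hp : p ≈ p') (hq : q ≈ q')
    (h : p.chr = TightChar.act q.elt q.chr q.mem)
    (h' : p'.chr = TightChar.act q'.elt q'.chr q'.mem) : mulPair p q h ≈ mulPair p' q' h' := by
  obtain ⟨h1, e, he, hpe⟩ := hp
  obtain ⟨h2, f, hf, hqf⟩ := hq
  refine ⟨h2, f ⊓ conj q.elt e, ?_, ?_⟩
  · change q.chr.1 (f ⊓ conj q.elt e) = true
    rw [q.chr.2.map_inf, hf]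
    rw [h] at he
    exact he
  · change p.elt * q.elt * (f.1 * (star q.elt * e.1 * q.elt)) =
      p'.elt * q'.elt * (f.1 * (star q.elt * e.1 * q.elt))
    have hf' : ∀ r : S, r * q.elt * (f.1 * (star q.elt * e.1 * q.elt)) =
        (r * e.1) * (q.elt * f.1) := by
      intro r
      calc r * q.elt * (f.1 * (star q.elt * e.1 * q.elt))
          = r * q.elt * ((star q.elt * e.1 * q.elt) * f.1) := by
            rw [idem_comm _ _ f.2 (conj_idem q.elt e.2)]
        _ = r * (q.elt * (star q.elt * e.1 * q.elt)) * f.1 := by simp only [mul_assoc]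
        _ = r * (e.1 * q.elt) * f.1 := by rw [← idem_mul q.elt e.2]
        _ = (r * e.1) * (q.elt * f.1) := by simp only [mul_assoc]
    rw [hf']
    have : p'.elt * q'.elt * (f.1 * (star q.elt * e.1 * q.elt)) =
        p'.elt * q.elt * (f.1 * (star q.elt * e.1 * q.elt)) := by
      rw [← mul_assoc, mul_assoc p'.elt, ← hqf]
      simp only [mul_assoc]
    rw [this, hf', hpe]

/-- The product `[s, ρ_t(ψ)] [t, ψ] = [s t, ψ]`. -/
def mul (x y : TightGroupoid S) : source x = range y → TightGroupoid S :=
  Quotient.hrecOn₂ (φ := fun x y : TightGroupoid S => source x = range y → TightGroupoid S) x y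
    (fun p q h => Quotient.mk (germSetoid S) (mulPair p q h))
    (by
      intro p q p' q' hp hq
      apply Function.hfunext
      · rw [Quotient.sound hp, Quotient.sound hq]
      · intro h h' _
        exact heq_of_eq (Quotient.sound (mulPair_congr hp hq h h')))

theorem inv_mem (p : GermPair S) :
    (TightChar.act p.elt p.chr p.mem).1 (dom (star p.elt)) = true := by
  change p.chr.1 (conj p.elt (dom (star p.elt))) = true
  have : conj p.elt (dom (star p.elt)) = dom p.elt := by
    apply Subtype.ext
    change star p.elt * (star (star p.elt) * star p.elt) * p.elt = star p.elt * p.elt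
    rw [star_invol, ← mul_assoc, star_mul_self_mul_star]
  rw [this, p.mem]

/-- The inverse `[s, φ]⁻¹ = [s⋆, ρ_s(φ)]`. -/
def inv (x : TightGroupoid S) : TightGroupoid S :=
  Quotient.lift
    (fun p : GermPair S => Quotient.mk (germSetoid S)
      ⟨star p.elt, TightChar.act p.elt p.chr p.mem, inv_mem p⟩)
    (by
      rintro ⟨s, φ, hs⟩ ⟨t, ψ, ht⟩ ⟨h, e, he, hst⟩
      obtain rfl : φ = ψ := h
      have hst : s * e.1 = t * e.1 := hst
      have he : φ.1 e = true := he
      apply Quotient.sound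
      refine ⟨TightChar.act_congr hs ht e he hst, conj (star s) e, ?_, ?_⟩
      · change φ.1 (conj s (conj (star s) e)) = true
        have : conj s (conj (star s) e) = dom s ⊓ (e ⊓ dom s) := by
          apply Subtype.ext
          change star s * (star (star s) * e.1 * star s) * s = (star s * s) * (e.1 * (star s * s))
          rw [star_invol]
          simp only [mul_assoc]
        have hs' : φ.1 (dom s) = true := hs
        rw [this, φ.2.map_inf, φ.2.map_inf, he, hs']
        rfl
      · change star s * (star (star s) * e.1 * star s) = star t * (star (star s) * e.1 * star s)
        rw [star_invol]
        have hstar : e.1 * star s = e.1 * star t := by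
          have := congrArg star hst
          rwa [star_of_mul, star_of_mul, star_idem e.2] at this
        have h1 : ∀ r : S, star r * (r * e.1 * star r) = e.1 * star r := by
          intro r
          have := idem_mul (star r) e.2
          rw [star_invol] at this
          exact this.symm
        have h2 : s * e.1 * star s = t * e.1 * star t := by
          rw [hst, mul_assoc, hstar, ← mul_assoc]
        rw [h1 s, h2, h1 t, hstar]) x

theorem act_act (s t : S) (ψ : TightChar S) (ht : ψ.1 (dom t) = true)
    (hs : (TightChar.act t ψ ht).1 (dom s) = true) (hst : ψ.1 (dom (s * t)) = true) :
    TightChar.act (s * t) ψ hst = TightChar.act s (TightChar.act t ψ ht) hs := by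
  apply Subtype.ext
  funext e
  change ψ.1 (conj (s * t) e) = ψ.1 (conj t (conj s e))
  rw [TightChar.conj_conj]

theorem act_star_act (s : S) (φ : TightChar S) (hs : φ.1 (dom s) = true)
    (hs' : (TightChar.act s φ hs).1 (dom (star s)) = true) :
    TightChar.act (star s) (TightChar.act s φ hs) hs' = φ := by
  apply Subtype.ext
  funext e
  change φ.1 (conj s (conj (star s) e)) = φ.1 e
  have : conj s (conj (star s) e) = dom s ⊓ (e ⊓ dom s) := by
    apply Subtype.ext
    change star s * (star (star s) * e.1 * star s) * s = (star s * s) * (e.1 * (star s * s))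
    rw [star_invol]
    simp only [mul_assoc]
  rw [this, φ.2.map_inf, φ.2.map_inf, hs]
  simp

/-- The groupoid structure on the set of germs. -/
instance : SetGroupoid (TightGroupoid S) where
  Composable x y := source x = range y
  comp := mul
  inv := inv
  inv_inv := by
    rintro ⟨s, φ, hs⟩
    apply Quotient.sound
    have h1 : star (star s) = s := star_invol s
    refine ⟨act_star_act s φ hs (inv_mem ⟨s, φ, hs⟩), dom s, ?_, ?_⟩
    · change (TightChar.act (star s) (TightChar.act s φ hs) (inv_mem ⟨s, φ, hs⟩)).1 (dom s) = true
      rw [act_star_act s φ hs (inv_mem ⟨s, φ, hs⟩)]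
      exact hs
    · change star (star s) * _ = s * _
      rw [h1]
  composable_comp_left := by
    rintro ⟨p⟩ ⟨q⟩ ⟨r⟩ hxy hyz
    exact hyz
  composable_comp_right := by
    rintro ⟨s, φ, hs⟩ ⟨t, ψ, ht⟩ ⟨r, χ, hr⟩ hxy hyz
    have hxy' : φ = TightChar.act t ψ ht := hxy
    have hyz' : ψ = TightChar.act r χ hr := hyz
    subst hxy'
    subst hyz'
    exact (act_act t r χ hr ht (mul_mem (p := ⟨t, _, ht⟩) (q := ⟨r, χ, hr⟩) rfl)).symm
  assoc := by
    rintro ⟨s, φ, hs⟩ ⟨t, ψ, ht⟩ ⟨r, χ, hr⟩ hxy hyz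
    apply Quotient.sound
    refine ⟨rfl, dom r, hr, ?_⟩
    change s * t * r * _ = s * (t * r) * _
    rw [mul_assoc s]
  composable_inv_left := by
    rintro ⟨s, φ, hs⟩
    rfl
  composable_inv_right := by
    rintro ⟨s, φ, hs⟩
    exact (act_star_act s φ hs (inv_mem ⟨s, φ, hs⟩)).symm
  inv_comp_cancel := by
    rintro ⟨s, φ, hs⟩ ⟨t, ψ, ht⟩ hxy
    apply Quotient.sound
    refine ⟨rfl, dom (s * t), mul_mem (p := ⟨s, φ, hs⟩) (q := ⟨t, ψ, ht⟩) hxy, ?_⟩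
    change star s * (s * t) * (star (s * t) * (s * t)) = t * (star (s * t) * (s * t))
    have h1 : star (s * t) * (s * t) = star t * (star s * s) * t := by
      rw [star_of_mul]
      simp only [mul_assoc]
    rw [h1, ← idem_mul t (star_mul_idem s)]
    calc star s * (s * t) * (star t * (star s * s) * t)
        = (star s * s) * (t * (star t * (star s * s) * t)) := by simp only [mul_assoc]
      _ = (star s * s) * (star s * s * t) := by rw [← idem_mul t (star_mul_idem s)]
      _ = star s * s * t := by rw [← mul_assoc, star_mul_idem]
  comp_inv_cancel := by
    rintro ⟨s, φ, hs⟩ ⟨t, ψ, ht⟩ hxy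
    have hxy' : φ = TightChar.act t ψ ht := hxy
    subst hxy'
    apply Quotient.sound
    refine ⟨rfl, dom (star t), inv_mem ⟨t, ψ, ht⟩, ?_⟩
    change s * t * star t * (star (star t) * star t) = s * (star (star t) * star t)
    rw [star_invol, mul_assoc s, mul_assoc s, mul_star_idem]

end TightGroupoid

/-! ### Finite and infinite words -/

/-- `L^{≤∞}`: finite words and infinite words over `L`. -/
inductive Word (L : Type v) : Type v
  | fin : List L → Word L
  | inf : Stream' L → Word L

namespace Word

variable {L : Type v}

/-- Add one letter in front. -/
def cons (a : L) : Word L → Word L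
  | fin w => fin (a :: w)
  | inf x => inf (Stream'.cons a x)

/-- The concatenation `αγ` of a finite word `α` and a finite or infinite word `γ`. -/
def append : List L → Word L → Word L
  | [], γ => γ
  | a :: w, γ => cons a (append w γ)

/-- The length `|α|`. -/
def length : Word L → ℕ∞
  | fin w => (w.length : ℕ∞)
  | inf _ => ⊤

/-- The initial segment `α_{1,n}` (all of `α` if `n` exceeds the length of `α`). -/
def take (n : ℕ) : Word L → List L
  | fin w => w.take n
  | inf x => x.take n

/-- `w` is a beginning of `α`. -/
def IsBeginning (w : List L) (α : Word L) : Prop := ∃ γ, α = append w γ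

theorem cons_inj {a b : L} {γ δ : Word L} (h : cons a γ = cons b δ) : a = b ∧ γ = δ := by
  cases γ <;> cases δ <;> simp only [cons, fin.injEq, inf.injEq, List.cons.injEq,
    reduceCtorEq] at h
  · exact ⟨h.1, by rw [h.2]⟩
  · obtain ⟨h1, h2⟩ := Stream'.cons_injective2 h
    exact ⟨h1, by rw [h2]⟩

theorem append_append (u w : List L) (γ : Word L) :
    append (u ++ w) γ = append u (append w γ) := by
  induction u with
  | nil => rfl
  | cons a u ih => exact congrArg (cons a) ih

theorem append_fin (u w : List L) : append u (fin w) = fin (u ++ w) := by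
  induction u with
  | nil => rfl
  | cons a u ih => simp [append, ih, cons]

theorem take_cons (a : L) (γ : Word L) (n : ℕ) : take (n + 1) (cons a γ) = a :: take n γ := by
  cases γ <;> rfl

theorem length_cons (a : L) (γ : Word L) : length (cons a γ) = length γ + 1 := by
  cases γ <;> simp [length, cons]

theorem take_append (u : List L) (γ : Word L) (n : ℕ) :
    take (u.length + n) (append u γ) = u ++ take n γ := by
  induction u with
  | nil => simp [append]
  | cons a u ih =>
    have : (a :: u).length + n = (u.length + n) + 1 := by simp; omega
    rw [this]
    simp [append, take_cons, ih]

theorem take_zero (γ : Word L) : take 0 γ = [] := by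
  cases γ <;> rfl

theorem take_length_append (u : List L) (γ : Word L) : take u.length (append u γ) = u := by
  have := take_append u γ 0
  simpa [take_zero] using this

theorem length_append (u : List L) (γ : Word L) :
    length (append u γ) = (u.length : ℕ∞) + length γ := by
  induction u with
  | nil => simp [append]
  | cons a u ih =>
    simp only [append, length_cons, ih, List.length_cons, Nat.cast_add, Nat.cast_one]
    rw [add_assoc, add_assoc, add_comm (length γ)]

theorem isBeginning_take (γ : Word L) (n : ℕ) : IsBeginning (take n γ) γ := by
  cases γ with
  | fin w => exact ⟨fin (w.drop n), by rw [append_fin]; simp [take]⟩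
  | inf x =>
    induction n generalizing x with
    | zero => exact ⟨inf x, rfl⟩
    | succ n ih =>
      obtain ⟨δ, hδ⟩ := ih x.tail
      refine ⟨δ, ?_⟩
      have : inf x = cons x.head (inf x.tail) := by
        simp [cons, Stream'.eta]
      rw [this, take_cons, append, ← hδ]

/-- Two decompositions of the same word are comparable. -/
theorem append_eq_append {u w : List L} {γ δ : Word L} (h : append u γ = append w δ)
    (hl : u.length ≤ w.length) : ∃ v, w = u ++ v ∧ γ = append v δ := by
  induction u generalizing w with
  | nil => exact ⟨w, rfl, h⟩
  | cons a u ih =>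
    cases w with
    | nil => simp at hl
    | cons b w =>
      obtain ⟨rfl, h'⟩ := cons_inj h
      obtain ⟨v, rfl, hv⟩ := ih h' (by simpa using hl)
      exact ⟨v, rfl, hv⟩

end Word

/-! ### Generalized Boolean dynamical systems -/

/-- A generalized Boolean dynamical system: a (not necessarily unital) Boolean algebra `B`, a set
`L`, an action `θ_α` on `B` for each `α ∈ L`, and ideals `I_α` that contain
`R_α = {A : A ≤ θ_α(C) for some C}`. -/
structure GBDS (B : Type u) [GeneralizedBooleanAlgebra B] (L : Type v) where
  θ : L → B → B
  map_bot : ∀ a, θ a ⊥ = ⊥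
  map_inf : ∀ a A C, θ a (A ⊓ C) = θ a A ⊓ θ a C
  map_sup : ∀ a A C, θ a (A ⊔ C) = θ a A ⊔ θ a C
  map_sdiff : ∀ a A C, θ a (A \ C) = θ a A \ θ a C
  I : L → Order.Ideal B
  range_subset : ∀ a, {A | ∃ C, A ≤ θ a C} ⊆ (I a : Set B)

namespace GBDS

variable {B : Type u} [GeneralizedBooleanAlgebra B] {L : Type v} (D : GBDS B L)

/-- `θ_α` for a finite word `α`: the composition `θ_{α_n} ∘ ⋯ ∘ θ_{α_1}`. -/
def act : List L → B → B
  | [], A => A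
  | a :: w, A => act w (D.θ a A)

/-- `I_α` for a finite word `α`, with `I_∅ = B`. -/
def ideal : List L → Set B
  | [] => Set.univ
  | a :: w => {A | ∃ C ∈ D.I a, A ≤ D.act w C}

/-- `W^{≤∞}`: the finite words `w` with `I_w ≠ {∅}`, and the infinite words `x` with
`I_{x_{1,n}} ≠ {∅}` for all `n ≥ 1`. -/
def words : Set (Word L) := fun α =>
  match α with
  | .fin w => D.ideal w ≠ {⊥}
  | .inf x => ∀ n, 1 ≤ n → D.ideal (x.take n) ≠ {⊥}

theorem act_append (u w : List L) (A : B) : D.act (u ++ w) A = D.act w (D.act u A) := by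
  induction u generalizing A with
  | nil => rfl
  | cons a u ih => exact ih _

theorem act_bot (w : List L) : D.act w ⊥ = ⊥ := by
  induction w with
  | nil => rfl
  | cons a w ih => rw [act, D.map_bot, ih]

theorem act_inf (w : List L) (A C : B) : D.act w (A ⊓ C) = D.act w A ⊓ D.act w C := by
  induction w generalizing A C with
  | nil => rfl
  | cons a w ih => simp only [act, D.map_inf, ih]

theorem act_mono (w : List L) {A C : B} (h : A ≤ C) : D.act w A ≤ D.act w C := by
  rw [← inf_eq_left, ← act_inf, inf_eq_left.2 h]

theorem ideal_lower {w : List L} {A C : B} (h : A ≤ C) (hC : C ∈ D.ideal w) :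
    A ∈ D.ideal w := by
  cases w with
  | nil => trivial
  | cons a w =>
    obtain ⟨X, hX, hCX⟩ := hC
    exact ⟨X, hX, h.trans hCX⟩

theorem act_mem_ideal {u : List L} (w : List L) {A : B} (h : A ∈ D.ideal u) :
    D.act w A ∈ D.ideal (u ++ w) := by
  cases u with
  | nil =>
    cases w with
    | nil => trivial
    | cons a w => exact ⟨D.θ a A, D.range_subset a ⟨A, le_rfl⟩, le_rfl⟩
  | cons a u =>
    obtain ⟨X, hX, hAX⟩ := h
    refine ⟨X, hX, ?_⟩
    change _ ≤ D.act (u ++ w) X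
    rw [act_append]
    exact D.act_mono w hAX

theorem ideal_append_subset (u w : List L) {A : B} (h : A ∈ D.ideal (u ++ w)) :
    A ∈ D.ideal w := by
  cases u with
  | nil => exact h
  | cons a u =>
    obtain ⟨X, hX, hAX⟩ := h
    cases w with
    | nil => trivial
    | cons b w =>
      refine ⟨D.θ b (D.act u X), D.range_subset b ⟨_, le_rfl⟩, ?_⟩
      change A ≤ D.act (u ++ b :: w) X at hAX
      rw [act_append] at hAX
      exact hAX

/-- Elements of `I_{uw}` below `θ_w(A)` come from `I_u`, if `u` is not empty. -/
theorem exists_mem_ideal {u : List L} (hu : u ≠ []) (w : List L) {A C : B}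
    (hC : C ∈ D.ideal (u ++ w)) (hCA : C ≤ D.act w A) :
    ∃ A' ∈ D.ideal u, A' ≤ A ∧ C ≤ D.act w A' := by
  cases u with
  | nil => exact absurd rfl hu
  | cons a u =>
    obtain ⟨X, hX, hCX⟩ := hC
    change C ≤ D.act (u ++ w) X at hCX
    rw [act_append] at hCX
    refine ⟨D.act u X ⊓ A, ⟨X, hX, inf_le_left⟩, inf_le_right, ?_⟩
    rw [act_inf]
    exact le_inf hCX hCA

/-! ### The inverse semigroup -/

/-- The set of triples `(α, A, β)` with `∅ ≠ A ∈ I_α ∩ I_β`, together with `0`. -/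
inductive Semi (D : GBDS B L) : Type (max u v)
  | zero : Semi D
  | tri (α : List L) (A : B) (β : List L) (hα : A ∈ D.ideal α) (hβ : A ∈ D.ideal β)
      (hA : A ≠ ⊥) : Semi D

namespace Semi

variable {D}

open Classical in
/-- The product of `S`. The case `β = γ` is the common special case of the first two cases. -/
noncomputable def mul : Semi D → Semi D → Semi D
  | zero, _ => zero
  | tri _ _ _ _ _ _, zero => zero
  | tri α A β hα _ _, tri γ C δ _ hδ _ =>
    if h : (∃ w, γ = β ++ w ∧ D.act w A ⊓ C ≠ ⊥) then
      tri (α ++ h.choose) (D.act h.choose A ⊓ C) δ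
        (D.ideal_lower inf_le_left (D.act_mem_ideal _ hα))
        (D.ideal_lower inf_le_right hδ) h.choose_spec.2
    else if h : (∃ w, β = γ ++ w ∧ A ⊓ D.act w C ≠ ⊥) then
      tri α (A ⊓ D.act h.choose C) (δ ++ h.choose)
        (D.ideal_lower inf_le_left hα)
        (D.ideal_lower inf_le_right (D.act_mem_ideal _ hδ)) h.choose_spec.2
    else zero

/-- `(α, A, β)⋆ = (β, A, α)`. -/
def inv : Semi D → Semi D
  | zero => zero
  | tri α A β hα hβ hA => tri β A α hβ hα hA

/-- For each `C`, the partial bijection of finite words `βw ↦ αw`, for `w` with `C ≤ θ_w(A)`, that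
is given by `(α, A, β)`. It is used to verify the laws of `S`. -/
def Rel (C : B) : Semi D → List L → List L → Prop
  | zero, _, _ => False
  | tri α A β _ _ _, x, y => ∃ w, x = α ++ w ∧ y = β ++ w ∧ C ≤ D.act w A

theorem rel_mul (s t : Semi D) {C : B} (hC : C ≠ ⊥) (x y : List L) :
    Rel C (mul s t) x y ↔ ∃ z, Rel C s x z ∧ Rel C t z y := by
  cases s with
  | zero => simp [mul, Rel]
  | tri α A β hα hβ hA =>
    cases t with
    | zero => simp [mul, Rel]
    | tri γ A' δ hγ hδ hA' =>
      have key1 : ∀ v, γ = β ++ v → ((∃ z, (∃ w, x = α ++ w ∧ z = β ++ w ∧ C ≤ D.act w A) ∧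
          ∃ w, z = γ ++ w ∧ y = δ ++ w ∧ C ≤ D.act w A') ↔
          ∃ w, x = (α ++ v) ++ w ∧ y = δ ++ w ∧ C ≤ D.act w (D.act v A ⊓ A')) := by
        rintro v rfl
        constructor
        · rintro ⟨z, ⟨w, rfl, rfl, h1⟩, w', h2, rfl, h3⟩
          rw [List.append_assoc] at h2
          have := List.append_cancel_left h2
          subst this
          refine ⟨w', by simp, rfl, ?_⟩
          rw [act_inf, ← act_append]
          exact le_inf h1 h3
        · rintro ⟨w, rfl, rfl, h⟩
          rw [act_inf, ← act_append] at h
          exact ⟨β ++ (v ++ w), ⟨v ++ w, by simp, rfl, h.trans inf_le_left⟩,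
            w, by simp, rfl, h.trans inf_le_right⟩
      have key2 : ∀ v, β = γ ++ v → ((∃ z, (∃ w, x = α ++ w ∧ z = β ++ w ∧ C ≤ D.act w A) ∧
          ∃ w, z = γ ++ w ∧ y = δ ++ w ∧ C ≤ D.act w A') ↔
          ∃ w, x = α ++ w ∧ y = (δ ++ v) ++ w ∧ C ≤ D.act w (A ⊓ D.act v A')) := by
        rintro v rfl
        constructor
        · rintro ⟨z, ⟨w, rfl, rfl, h1⟩, w', h2, rfl, h3⟩
          rw [List.append_assoc] at h2
          have := List.append_cancel_left h2
          subst this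
          refine ⟨w, rfl, by simp, ?_⟩
          rw [act_inf, ← act_append]
          exact le_inf h1 h3
        · rintro ⟨w, rfl, rfl, h⟩
          rw [act_inf, ← act_append] at h
          exact ⟨γ ++ v ++ w, ⟨w, rfl, rfl, h.trans inf_le_left⟩,
            v ++ w, by simp, by simp, h.trans inf_le_right⟩
      have hne : ∀ (w : List L) (X : B), C ≤ D.act w X → X ≠ ⊥ := by
        rintro w X h rfl
        rw [act_bot, le_bot_iff] at h
        exact hC h
      by_cases h1 : ∃ w, γ = β ++ w ∧ D.act w A ⊓ A' ≠ ⊥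
      · simp only [mul, h1, dif_pos, Rel]
        exact (key1 _ h1.choose_spec.1).symm
      · by_cases h2 : ∃ w, β = γ ++ w ∧ A ⊓ D.act w A' ≠ ⊥
        · simp only [mul, h1, h2, dif_pos, dif_neg, not_false_iff, Rel]
          exact (key2 _ h2.choose_spec.1).symm
        · simp only [mul, h1, h2, dif_neg, not_false_iff, Rel, false_iff]
          rintro ⟨z, ⟨w, hx, hz, h3⟩, w', hz', hy, h4⟩
          have hcomp : β ++ w = γ ++ w' := by rw [← hz, ← hz']
          rcases List.append_eq_append_iff.1 hcomp with ⟨v, hv, _⟩ | ⟨v, hv, _⟩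
          · obtain ⟨u, _, _, hu⟩ := (key1 v hv).1 ⟨z, ⟨w, hx, hz, h3⟩, w', hz', hy, h4⟩
            exact h1 ⟨v, hv, hne _ _ hu⟩
          · obtain ⟨u, _, _, hu⟩ := (key2 v hv).1 ⟨z, ⟨w, hx, hz, h3⟩, w', hz', hy, h4⟩
            exact h2 ⟨v, hv, hne _ _ hu⟩

theorem rel_inv (s : Semi D) (C : B) (x y : List L) : Rel C (inv s) x y ↔ Rel C s y x := by
  cases s with
  | zero => rfl
  | tri α A β hα hβ hA =>
    constructor
    · rintro ⟨w, h1, h2, h3⟩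
      exact ⟨w, h2, h1, h3⟩
    · rintro ⟨w, h1, h2, h3⟩
      exact ⟨w, h2, h1, h3⟩

theorem rel_ext {s t : Semi D} (h : ∀ C : B, C ≠ ⊥ → ∀ x y, Rel C s x y ↔ Rel C t x y) :
    s = t := by
  cases s with
  | zero =>
    cases t with
    | zero => rfl
    | tri γ A' δ hγ hδ hA' =>
      exact ((h A' hA' γ δ).2 ⟨[], by simp, by simp, le_rfl⟩).elim
  | tri α A β hα hβ hA =>
    cases t with
    | zero => exact ((h A hA α β).1 ⟨[], by simp, by simp, le_rfl⟩).elim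
    | tri γ A' δ hγ hδ hA' =>
      obtain ⟨w, h1, h2, h3⟩ := (h A hA α β).1 ⟨[], by simp, by simp, le_rfl⟩
      obtain ⟨w', h4, h5, h6⟩ := (h A' hA' γ δ).2 ⟨[], by simp, by simp, le_rfl⟩
      have hlen := congrArg List.length h1
      have hlen' := congrArg List.length h4
      simp only [List.length_append] at hlen hlen'
      have hw : w = [] := List.length_eq_zero_iff.1 (by omega)
      have hw' : w' = [] := List.length_eq_zero_iff.1 (by omega)
      subst hw
      subst hw'
      simp only [List.append_nil] at h1 h2
      subst h1
      subst h2
      have : A = A' := le_antisymm h3 h6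
      subst this
      rfl

theorem rel_right_unique (s : Semi D) {C : B} {x y z : List L} (h : Rel C s x y)
    (h' : Rel C s x z) : y = z := by
  cases s with
  | zero => exact h.elim
  | tri α A β hα hβ hA =>
    obtain ⟨w, rfl, rfl, _⟩ := h
    obtain ⟨w', h1, rfl, _⟩ := h'
    rw [List.append_cancel_left h1]

theorem rel_left_unique (s : Semi D) {C : B} {x y z : List L} (h : Rel C s y x)
    (h' : Rel C s z x) : y = z :=
  rel_right_unique (inv s) ((rel_inv s C x y).2 h) ((rel_inv s C x z).2 h')

theorem rel_idem {e : Semi D} (he : mul e e = e) {C : B} (hC : C ≠ ⊥) {x y : List L}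
    (h : Rel C e x y) : x = y := by
  have h1 := h
  rw [← he, rel_mul _ _ hC] at h1
  obtain ⟨z, hxz, hzy⟩ := h1
  have := rel_right_unique e hxz h
  subst this
  exact rel_left_unique e h hzy

noncomputable instance : InverseSemigroupWithZero (Semi D) where
  mul := mul
  zero := zero
  star := inv
  mul_assoc s t r := by
    apply rel_ext
    intro C hC x y
    change Rel C (mul (mul s t) r) x y ↔ Rel C (mul s (mul t r)) x y
    simp only [rel_mul _ _ hC]
    constructor
    · rintro ⟨z, ⟨w, h1, h2⟩, h3⟩
      exact ⟨w, h1, z, h2, h3⟩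
    · rintro ⟨w, h1, z, h2, h3⟩
      exact ⟨z, ⟨w, h1, h2⟩, h3⟩
  zero_mul s := rfl
  mul_zero s := by cases s <;> rfl
  mul_star_mul_self s := by
    apply rel_ext
    intro C hC x y
    change Rel C (mul (mul s (inv s)) s) x y ↔ _
    simp only [rel_mul _ _ hC, rel_inv]
    constructor
    · rintro ⟨z, ⟨w, h1, h2⟩, h3⟩
      rw [rel_left_unique s h1 h2]
      exact h3
    · intro h
      exact ⟨x, ⟨y, h, h⟩, h⟩
  star_mul_self_mul_star s := by
    apply rel_ext
    intro C hC x y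
    change Rel C (mul (mul (inv s) s) (inv s)) x y ↔ Rel C (inv s) x y
    simp only [rel_mul _ _ hC, rel_inv]
    constructor
    · rintro ⟨z, ⟨w, h1, h2⟩, h3⟩
      rw [rel_right_unique s h1 h2]
      exact h3
    · intro h
      exact ⟨x, ⟨y, h, h⟩, h⟩
  idem_comm e f he hf := by
    apply rel_ext
    intro C hC x y
    change Rel C (mul e f) x y ↔ Rel C (mul f e) x y
    simp only [rel_mul _ _ hC]
    constructor
    · rintro ⟨z, h1, h2⟩
      obtain rfl := rel_idem he hC h1
      obtain rfl := rel_idem hf hC h2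
      exact ⟨x, h2, h1⟩
    · rintro ⟨z, h1, h2⟩
      obtain rfl := rel_idem hf hC h1
      obtain rfl := rel_idem he hC h2
      exact ⟨x, h2, h1⟩

/-- The idempotent `(α, A, α)`. -/
noncomputable def idem (α : List L) (A : B) (h : A ∈ D.ideal α) (hA : A ≠ ⊥) : Idem (Semi D) :=
  ⟨tri α A α h h hA, by
    apply rel_ext
    intro C hC x y
    change Rel C (mul _ _) x y ↔ _
    rw [rel_mul _ _ hC]
    simp only [Rel]
    constructor
    · rintro ⟨z, ⟨w, rfl, rfl, h1⟩, w', h2, rfl, h3⟩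
      exact ⟨w', h2, rfl, h3⟩
    · rintro ⟨w, rfl, rfl, h1⟩
      exact ⟨_, ⟨w, rfl, rfl, h1⟩, w, rfl, rfl, h1⟩⟩

theorem idem_le_idem {α β : List L} {A C : B} (h : A ∈ D.ideal α) (hA : A ≠ ⊥)
    (h' : C ∈ D.ideal β) (hC : C ≠ ⊥) :
    idem α A h hA ≤ idem β C h' hC ↔ ∃ w, α = β ++ w ∧ A ≤ D.act w C := by
  constructor
  · intro hle
    have hle' : mul (tri α A α h h hA) (tri β C β h' h' hC) = tri α A α h h hA := hle
    have h1 : Rel A (tri α A α h h hA) α α := ⟨[], by simp, by simp, le_rfl⟩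
    rw [← hle', rel_mul _ _ hA] at h1
    obtain ⟨z, ⟨w, h2, h3, _⟩, w', h4, h5, h6⟩ := h1
    exact ⟨w', h5, h6⟩
  · rintro ⟨v, rfl, hle⟩
    change mul _ _ = _
    apply rel_ext
    intro X hX x y
    rw [rel_mul _ _ hX]
    simp only [Rel, idem]
    constructor
    · rintro ⟨z, ⟨w, rfl, rfl, h1⟩, w', h2, rfl, h3⟩
      exact ⟨w, rfl, h2.symm, h1⟩
    · rintro ⟨w, rfl, rfl, h1⟩
      refine ⟨_, ⟨w, rfl, rfl, h1⟩, v ++ w, by simp, by simp, ?_⟩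
      rw [act_append]
      exact h1.trans (D.act_mono w hle)

theorem bot_or_idem (p : Idem (Semi D)) :
    p = ⊥ ∨ ∃ α A, ∃ (h : A ∈ D.ideal α) (hA : A ≠ ⊥), p = idem α A h hA := by
  obtain ⟨s, hs⟩ := p
  cases s with
  | zero => exact Or.inl rfl
  | tri α A β hα hβ hA =>
    right
    have : α = β := rel_idem hs hA (C := A) ⟨[], by simp, by simp, le_rfl⟩
    subst this
    exact ⟨α, A, hα, hA, rfl⟩

end Semi

open Semi

/-! ### Words and families of filters associated with a filter in `E(S)` -/

/-- `{A ∈ I_w : (w, A, w) ∈ ξ}`. -/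
def slice (ξ : Set (Idem (Semi D))) (w : List L) : Set B :=
  {A | ∃ (h : A ∈ D.ideal w) (hA : A ≠ ⊥), idem w A h hA ∈ ξ}

/-- `α ∈ W^{≤∞}` is the word associated with `ξ`: the words of the elements of `ξ` are beginnings of
`α`, and their lengths reach or approach the length of `α`. -/
structure IsWordOf (ξ : Set (Idem (Semi D))) (α : Word L) : Prop where
  mem_words : α ∈ D.words
  isBeginning : ∀ w, (D.slice ξ w).Nonempty → Word.IsBeginning w α
  cofinal : ∀ n : ℕ, (n : ℕ∞) ≤ α.length → ∃ w, n ≤ w.length ∧ (D.slice ξ w).Nonempty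

/-- The filter in `E(S)` associated with a word `γ` and a family `F_n`, `0 ≤ n ≤ |γ|`: the union of
the sets of all elements above `(γ_{1,n}, A, γ_{1,n})`, for `A ∈ F_n`. -/
def ofFamily (γ : Word L) (F : ℕ → Set B) : Set (Idem (Semi D)) :=
  {p | ∃ n : ℕ, (n : ℕ∞) ≤ γ.length ∧ ∃ A ∈ F n, ∃ (h : A ∈ D.ideal (γ.take n)) (hA : A ≠ ⊥),
    idem (γ.take n) A h hA ≤ p}

/-! ### Cutting and gluing -/

/-- The cutting map `H_{[α]γ}`, for filters `ξ` with word `αγ`. For `α ≠ ∅`, the family of the result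
is `↑ ξ_{n+|α|}`, taken in `I_{γ_{1,n}}`. -/
def cut (α : List L) (γ : Word L) (ξ : Set (Idem (Semi D))) : Set (Idem (Semi D)) :=
  match α with
  | [] => ξ
  | a :: w => D.ofFamily γ fun n =>
      {A | A ∈ D.ideal (γ.take n) ∧
        ∃ C ∈ D.slice ξ ((Word.append (a :: w) γ).take ((a :: w).length + n)), C ≤ A}

/-- `N = |α|` if `γ = ∅`, and `N = |α| + 1` otherwise. -/
def glueTop (α : List L) : Word L → ℕ
  | .fin [] => α.length
  | _ => α.length + 1

open Classical in
/-- The family `J_i` for the word `αγ` that is obtained by gluing `α` to a filter `ξ` with word `γ`.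
With `N = |α|` if `γ = ∅` and `N = |α| + 1` otherwise, `J_i` is `ξ_{i-|α|} ∩ I_{(αγ)_{1,i}}` for
`i ≥ N`, and `J_i = {A ∈ I_{(αγ)_{1,i}} : θ_{(αγ)_{i+1}}(A) ∈ J_{i+1}}` for `i < N`. -/
noncomputable def glueFamily (α : List L) (γ : Word L) (ξ : Set (Idem (Semi D))) (i : ℕ) : Set B :=
  if i < glueTop α γ then
    {A | A ∈ D.ideal ((Word.append α γ).take i) ∧
      D.act (((Word.append α γ).take (i + 1)).drop i) A ∈ glueFamily α γ ξ (i + 1)}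
  else
    D.slice ξ (γ.take (i - α.length)) ∩ D.ideal ((Word.append α γ).take i)
termination_by glueTop α γ - i

/-- The gluing map `G_{(α)γ}`. -/
noncomputable def glue (α : List L) (γ : Word L) (ξ : Set (Idem (Semi D))) :
    Set (Idem (Semi D)) :=
  match α with
  | [] => ξ
  | a :: w => D.ofFamily (Word.append (a :: w) γ) (D.glueFamily (a :: w) γ ξ)

/-- `T_α`: the tight filters with associated word `α`. -/
def tightAt (α : Word L) : Set (TightFilter (Semi D)) := {ξ | D.IsWordOf ξ.1 α}

/-- `T_{(α)γ}`: all of `T_γ` if `α = ∅`, and otherwise those `ξ ∈ T_γ` for which `ξ_0` meets `I_α`. -/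
def tightGlueable (α : List L) (γ : Word L) : Set (TightFilter (Semi D)) :=
  {ξ | ξ ∈ D.tightAt γ ∧ (α ≠ [] → (D.slice ξ.1 [] ∩ D.ideal α).Nonempty)}

/-! ### The groupoid `Γ` -/

/-- The set `Γ` of triples `(η, |α| - |β|, ξ)` of tight filters `η` and `ξ` with words `αγ` and `βγ`
and an integer, such that `H_{[α]γ}(η) = H_{[β]γ}(ξ)`. -/
def boundarySet : Set (TightFilter (Semi D) × ℤ × TightFilter (Semi D)) :=
  {x | ∃ (α β : List L) (γ : Word L), x.1 ∈ D.tightAt (Word.append α γ) ∧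
    x.2.2 ∈ D.tightAt (Word.append β γ) ∧ x.2.1 = (α.length : ℤ) - (β.length : ℤ) ∧
    D.cut α γ x.1.1 = D.cut β γ x.2.2.1}

/-- `Γ` as a type. -/
def BoundaryGroupoid : Type (max u v) := D.boundarySet

section closure

variable {D}

theorem IsWordOf.unique {ξ : Set (Idem (Semi D))} {α β : Word L} (hα : D.IsWordOf ξ α)
    (hβ : D.IsWordOf ξ β) : α = β := by
  have key : ∀ {α β : Word L}, D.IsWordOf ξ α → D.IsWordOf ξ β →
      ∀ n : ℕ, (n : ℕ∞) ≤ α.length → (n : ℕ∞) ≤ β.length ∧ α.take n = β.take n := by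
    intro α β hα hβ n hn
    obtain ⟨w, hw, hs⟩ := hα.cofinal n hn
    obtain ⟨γ, rfl⟩ := hα.isBeginning w hs
    obtain ⟨δ, rfl⟩ := hβ.isBeginning w hs
    refine ⟨?_, ?_⟩
    · rw [Word.length_append]
      exact le_trans (by exact_mod_cast hw) le_self_add
    · have hw' : w = w.take n ++ w.drop n := by simp
      have hl : (w.take n).length = n := by simp [hw]
      have : ∀ γ : Word L, (Word.append w γ).take n = w.take n := by
        intro γ
        conv_lhs => rw [hw', Word.append_append]
        have := Word.take_length_append (w.take n) (Word.append (w.drop n) γ)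
        rwa [hl] at this
      rw [this, this]
  cases α with
  | fin w =>
    cases β with
    | fin w' =>
      have h1 := key hα hβ w.length le_rfl
      have h2 := key hβ hα w'.length le_rfl
      have h3 : w.length ≤ w'.length := Nat.cast_le.1 h1.1
      have h4 : w'.length ≤ w.length := Nat.cast_le.1 h2.1
      have h5 := h1.2
      simp only [Word.take, List.take_length] at h5
      rw [List.take_of_length_le h4] at h5
      rw [h5]
    | inf x =>
      have h1 := (key hβ hα (w.length + 1) le_top).1
      have h2 : w.length + 1 ≤ w.length := Nat.cast_le.1 h1
      omega
  | inf x =>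
    cases β with
    | fin w =>
      have h1 := (key hα hβ (w.length + 1) le_top).1
      have h2 : w.length + 1 ≤ w.length := Nat.cast_le.1 h1
      omega
    | inf y =>
      rw [Stream'.take_theorem x y fun n => (key hα hβ n le_top).2]

/-- The elements of a filter that was cut. -/
theorem mem_cut {ξ : Set (Idem (Semi D))} (hξ : IsPosetFilter ξ) {α : List L} {γ : Word L}
    (hw : D.IsWordOf ξ (Word.append α γ)) (w : List L) (A : B) (h : A ∈ D.ideal w)
    (hA : A ≠ ⊥) :
    idem w A h hA ∈ D.cut α γ ξ ↔
      Word.IsBeginning w γ ∧ ∃ C ∈ D.slice ξ (α ++ w), C ≤ A := by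
  cases α with
  | nil =>
    constructor
    · intro hm
      exact ⟨hw.isBeginning w ⟨A, h, hA, hm⟩, A, ⟨h, hA, hm⟩, le_rfl⟩
    · rintro ⟨_, C, ⟨hC, hC0, hm⟩, hCA⟩
      exact hξ.up _ _ hm ((idem_le_idem _ _ _ _).2 ⟨[], by simp, hCA⟩)
  | cons a u =>
    constructor
    · rintro ⟨n, hn, A', ⟨hA', C, hC, hCA⟩, _, hA0, hle⟩
      obtain ⟨v, hv, hle⟩ := (idem_le_idem _ _ _ _).1 hle
      rw [Word.take_append, hv] at hC
      obtain ⟨hC, hC0, hm⟩ := hC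
      refine ⟨?_, ?_⟩
      · obtain ⟨δ, hδ⟩ := Word.isBeginning_take γ n
        rw [hv, Word.append_append] at hδ
        exact ⟨_, hδ⟩
      · have hC' : C ∈ D.ideal (((a :: u) ++ w) ++ v) := by rwa [List.append_assoc]
        obtain ⟨X, hX, hXA, hCX⟩ := D.exists_mem_ideal (by simp) v hC' (hCA.trans hle)
        refine ⟨X, ⟨hX, ?_, ?_⟩, hXA⟩
        · rintro rfl
          rw [act_bot, le_bot_iff] at hCX
          exact hC0 hCX
        · exact hξ.up _ _ hm ((idem_le_idem _ _ _ _).2 ⟨v, by simp, hCX⟩)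
    · rintro ⟨⟨δ, rfl⟩, C, hC, hCA⟩
      have ht := Word.take_length_append w δ
      refine ⟨w.length, ?_, A, ⟨?_, C, ?_, hCA⟩, ?_, hA, ?_⟩
      · rw [Word.length_append]
        exact le_self_add
      · rwa [ht]
      · rwa [Word.take_append, ht]
      · rwa [ht]
      · exact (idem_le_idem _ _ _ _).2 ⟨[], by rw [ht]; simp, le_rfl⟩

theorem bot_notMem_cut {ξ : Set (Idem (Semi D))} (hξ : IsPosetFilter ξ) (α : List L)
    (γ : Word L) : ⊥ ∉ D.cut α γ ξ := by
  cases α with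
  | nil => exact hξ.bot_notMem
  | cons a u =>
    rintro ⟨n, hn, A, _, h, hA, hle⟩
    have h1 : idem (γ.take n) A h hA = ⊥ := le_bot_iff.1 hle
    have h2 := congrArg Subtype.val h1
    change tri _ _ _ _ _ _ = Semi.zero at h2
    cases h2

/-- Cutting twice from two filters whose first cuts agree gives the same result. -/
theorem cut_congr {ξ η : Set (Idem (Semi D))} (hξ : IsPosetFilter ξ) (hη : IsPosetFilter η)
    {α β v : List L} {γ : Word L} (hwξ : D.IsWordOf ξ (Word.append α (Word.append v γ)))
    (hwη : D.IsWordOf η (Word.append β (Word.append v γ)))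
    (h : D.cut α (Word.append v γ) ξ = D.cut β (Word.append v γ) η) :
    D.cut (α ++ v) γ ξ = D.cut (β ++ v) γ η := by
  have hwξ' := hwξ
  have hwη' := hwη
  rw [← Word.append_append] at hwξ' hwη'
  have key : ∀ {ξ η : Set (Idem (Semi D))} {α β : List L}, IsPosetFilter ξ → IsPosetFilter η →
      D.IsWordOf ξ (Word.append α (Word.append v γ)) →
      D.IsWordOf η (Word.append β (Word.append v γ)) →
      D.cut α (Word.append v γ) ξ = D.cut β (Word.append v γ) η →
      ∀ w, Word.IsBeginning w γ → ∀ A : B, (∃ C ∈ D.slice ξ ((α ++ v) ++ w), C ≤ A) →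
        ∃ C ∈ D.slice η ((β ++ v) ++ w), C ≤ A := by
    rintro ξ η α β hξ hη hwξ hwη h w ⟨δ, rfl⟩ A ⟨C, hC, hCA⟩
    rw [List.append_assoc] at hC ⊢
    have hC' : C ∈ D.ideal (v ++ w) := D.ideal_append_subset α _ hC.1
    have hC0 : C ≠ ⊥ := hC.2.1
    have hb : Word.IsBeginning (v ++ w) (Word.append v (Word.append w δ)) :=
      ⟨δ, by rw [Word.append_append]⟩
    have h1 := (mem_cut hξ hwξ (v ++ w) C hC' hC0).2 ⟨hb, C, hC, le_rfl⟩
    rw [h, mem_cut hη hwη] at h1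
    obtain ⟨_, C', hC', hle⟩ := h1
    exact ⟨C', hC', hle.trans hCA⟩
  ext p
  rcases bot_or_idem p with rfl | ⟨w, A, hw, hA, rfl⟩
  · exact iff_of_false (bot_notMem_cut hξ _ _) (bot_notMem_cut hη _ _)
  · rw [mem_cut hξ hwξ', mem_cut hη hwη']
    constructor
    · rintro ⟨hb, hC⟩
      exact ⟨hb, key hξ hη hwξ hwη h w hb A hC⟩
    · rintro ⟨hb, hC⟩
      exact ⟨hb, key hη hξ hwη hwξ h.symm w hb A hC⟩

theorem boundary_comp {η ξ ρ : TightFilter (Semi D)} {m n : ℤ}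
    (h : (η, m, ξ) ∈ D.boundarySet) (h' : (ξ, n, ρ) ∈ D.boundarySet) :
    (η, m + n, ρ) ∈ D.boundarySet := by
  obtain ⟨α, β, γ, hη, hξ, hm, hc⟩ := h
  obtain ⟨β', δ, γ', hξ', hρ, hn, hc'⟩ := h'
  have hη : D.IsWordOf η.1 (Word.append α γ) := hη
  have hξ : D.IsWordOf ξ.1 (Word.append β γ) := hξ
  have hξ' : D.IsWordOf ξ.1 (Word.append β' γ') := hξ'
  have hρ : D.IsWordOf ρ.1 (Word.append δ γ') := hρ
  have hm : m = (α.length : ℤ) - β.length := hm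
  have hn : n = (β'.length : ℤ) - δ.length := hn
  have hc : D.cut α γ η.1 = D.cut β γ ξ.1 := hc
  have hc' : D.cut β' γ' ξ.1 = D.cut δ γ' ρ.1 := hc'
  have heq := hξ.unique hξ'
  rcases le_total β.length β'.length with hl | hl
  · obtain ⟨v, rfl, rfl⟩ := Word.append_eq_append heq hl
    refine ⟨α ++ v, δ, γ', ?_, hρ, ?_, ?_⟩
    · change D.IsWordOf η.1 _
      rwa [Word.append_append]
    · change m + n = _
      rw [hm, hn]
      push_cast [List.length_append]
      ring
    · exact (cut_congr η.2.1 ξ.2.1 hη hξ hc).trans hc'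
  · obtain ⟨v, rfl, rfl⟩ := Word.append_eq_append heq.symm hl
    refine ⟨α, δ ++ v, γ, hη, ?_, ?_, ?_⟩
    · change D.IsWordOf ρ.1 _
      rwa [Word.append_append]
    · change m + n = _
      rw [hm, hn]
      push_cast [List.length_append]
      ring
    · exact hc.trans (cut_congr ξ.2.1 ρ.2.1 hξ' hρ hc')

theorem boundary_inv {η ξ : TightFilter (Semi D)} {m : ℤ} (h : (η, m, ξ) ∈ D.boundarySet) :
    (ξ, -m, η) ∈ D.boundarySet := by
  obtain ⟨α, β, γ, hη, hξ, hm, hc⟩ := h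
  refine ⟨β, α, γ, hξ, hη, ?_, hc.symm⟩
  have hm : m = (α.length : ℤ) - β.length := hm
  change -m = _
  rw [hm]
  ring

end closure

/-- The groupoid structure on `Γ` : `(η, m, ξ)(ξ, n, ρ) = (η, m + n, ρ)` and
`(η, m, ξ)⁻¹ = (ξ, -m, η)`. -/
instance : SetGroupoid D.BoundaryGroupoid where
  Composable x y := x.1.2.2 = y.1.1
  comp x y h := ⟨(x.1.1, x.1.2.1 + y.1.2.1, y.1.2.2), by
    obtain ⟨⟨η, m, ξ⟩, hx⟩ := x
    obtain ⟨⟨ξ', n, ρ⟩, hy⟩ := y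
    obtain rfl : ξ = ξ' := h
    exact boundary_comp hx hy⟩
  inv x := ⟨(x.1.2.2, -x.1.2.1, x.1.1), boundary_inv x.2⟩
  inv_inv := by
    rintro ⟨⟨η, m, ξ⟩, hx⟩
    apply Subtype.ext
    simp
  composable_comp_left _ _ _ _ h := h
  composable_comp_right _ _ _ h _ := h
  assoc := by
    rintro ⟨⟨η, m, ξ⟩, hx⟩ ⟨⟨ξ', n, ρ⟩, hy⟩ ⟨⟨ρ', k, τ⟩, hz⟩ h h'
    apply Subtype.ext
    simp [add_assoc]
  composable_inv_left _ := rfl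
  composable_inv_right _ := rfl
  inv_comp_cancel := by
    rintro ⟨⟨η, m, ξ⟩, hx⟩ ⟨⟨ξ', n, ρ⟩, hy⟩ h
    apply Subtype.ext
    have h : ξ = ξ' := h
    simp [h]
  comp_inv_cancel := by
    rintro ⟨⟨η, m, ξ⟩, hx⟩ ⟨⟨ξ', n, ρ⟩, hy⟩ h
    apply Subtype.ext
    have h : ξ = ξ' := h
    simp [h]

end GBDS

/-! Cutting and gluing are both instances of the standard action `ρ` of the inverse semigroup on
tight characters. The factorization `(β, A, γ) = (β, A, ∅)(∅, A, γ)` splits the action of a triple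
in two: `(∅, A, γ)` acts as the cutting map `H_[γ]` (`toFilter_act_eq_cut`) and `(β, A, ∅)` as the
gluing map `G_(β)` (`toFilter_act_eq_glue`). So `Φ` sends `[t, φ]` to (range, degree, source), with
`deg (β, A, γ) = |β| - |γ|`. Cut and glued filters are tight because the action preserves tight
characters. The degree is additive on nonzero products and vanishes on idempotents, hence is well
defined on germs; `Φ` is then a groupoid homomorphism almost by construction.

Injectivity: suppose `(β, A, γ)` and `(β', A', γ')` have the same source, range and degree. Say `γ`
is the shorter of `γ` and `γ'`. Since both are beginnings of the word of the source, and `β`, `β'`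
of that of the range, `γ' = γv` and `β' = βv'` with `|v| = |v'|`. Uniqueness of the word of the
range forces `v = v'`, and the two elements then agree below an idempotent of the filter
(`germ_eq_of_length_le`).

Surjectivity: if the cuts of `η` at `α` and of `ξ` at `β` agree and the words are not both empty,
some `A` lies in both slices (`exists_mem_slice_of_cut_eq`), and `(α, A, β)` carries `ξ` to `η`.

Equations and order relations in `S` are checked throughout on the partial bijections `Rel`, where
products become compositions. -/

/-! ### Tight characters and tight filters -/

theorem TightChar.toFilter_injective {S : Type u} [InverseSemigroupWithZero S] :
    Function.Injective (TightChar.toFilter (S := S)) := by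
  intro φ ψ h
  apply Subtype.ext
  funext e
  have h1 : e ∈ φ.toFilter.1 ↔ e ∈ ψ.toFilter.1 := by rw [h]
  exact Bool.eq_iff_iff.2 h1

theorem TightChar.toFilter_surjective {S : Type u} [InverseSemigroupWithZero S] :
    Function.Surjective (TightChar.toFilter (S := S)) := by
  intro ξ
  refine ⟨⟨charOf ξ.1, ξ.2.2⟩, ?_⟩
  apply Subtype.ext
  ext e
  simp [TightChar.toFilter, charOf]

/-! ### Beginnings of words -/

namespace Word

variable {L : Type v}

theorem append_left_cancel {u : List L} {γ δ : Word L} (h : append u γ = append u δ) : γ = δ := by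
  induction u with
  | nil => exact h
  | cons a u ih => exact ih (cons_inj h).2

theorem isBeginning_append_iff {u w : List L} {γ : Word L} :
    IsBeginning (u ++ w) (append u γ) ↔ IsBeginning w γ := by
  constructor
  · rintro ⟨δ, h⟩
    rw [append_append] at h
    exact ⟨δ, append_left_cancel h⟩
  · rintro ⟨δ, rfl⟩
    exact ⟨δ, by rw [append_append]⟩

theorem IsBeginning.le_length {w : List L} {γ : Word L} (h : IsBeginning w γ) :
    (w.length : ℕ∞) ≤ γ.length := by
  obtain ⟨δ, rfl⟩ := h
  rw [length_append]
  exact le_self_add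

theorem IsBeginning.take_eq {w : List L} {γ : Word L} (h : IsBeginning w γ) :
    γ.take w.length = w := by
  obtain ⟨δ, rfl⟩ := h
  exact take_length_append w δ

/-- Two beginnings of the same word are comparable. -/
theorem IsBeginning.exists_append {u w : List L} {γ : Word L} (hu : IsBeginning u γ)
    (hw : IsBeginning w γ) (hl : u.length ≤ w.length) : ∃ v, w = u ++ v := by
  obtain ⟨δ, rfl⟩ := hu
  obtain ⟨δ', h⟩ := hw
  obtain ⟨v, hv, _⟩ := append_eq_append h hl
  exact ⟨v, hv⟩

theorem length_take_of_le {γ : Word L} {n : ℕ} (h : (n : ℕ∞) ≤ γ.length) :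
    (γ.take n).length = n := by
  cases γ with
  | fin w =>
    have h' : n ≤ w.length := Nat.cast_le.1 h
    simp [take, h']
  | inf x => simp [take]

end Word

namespace GBDS

variable {B : Type u} [GeneralizedBooleanAlgebra B] {L : Type v} {D : GBDS B L}

open Semi

/-! ### The order of the idempotents -/

theorem Semi.idem_ne_bot {w : List L} {A : B} (h : A ∈ D.ideal w) (hA : A ≠ ⊥) :
    idem w A h hA ≠ ⊥ := by
  intro h1
  have h2 := congrArg Subtype.val h1
  change tri _ _ _ _ _ _ = Semi.zero at h2
  cases h2

theorem Semi.rel_idem_iff {w : List L} {A : B} (h : A ∈ D.ideal w) (hA : A ≠ ⊥) {X : B}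
    {y : List L} : Rel X (idem w A h hA).1 y y ↔ ∃ v, y = w ++ v ∧ X ≤ D.act v A := by
  constructor
  · rintro ⟨v, h1, _, h2⟩
    exact ⟨v, h1, h2⟩
  · rintro ⟨v, h1, h2⟩
    exact ⟨v, h1, h1, h2⟩

/-- Unlike `idem_le_idem`, this applies when `p` is given as a product such as `s⋆ e s`, whose `Rel`
is computed by `rel_mul`. -/
theorem Semi.idem_le_iff_rel {w : List L} {A : B} (h : A ∈ D.ideal w) (hA : A ≠ ⊥)
    (p : Idem (Semi D)) : idem w A h hA ≤ p ↔ Rel A p.1 w w := by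
  rcases bot_or_idem p with rfl | ⟨u, C, hC, hC0, rfl⟩
  · exact iff_of_false (fun h1 => idem_ne_bot h hA (le_bot_iff.1 h1)) id
  · rw [idem_le_idem, rel_idem_iff]

/-! ### Slices of a filter -/

section slices

variable {ξ : Set (Idem (Semi D))}

theorem mem_filter_iff (hξ : IsPosetFilter ξ) (p : Idem (Semi D)) :
    p ∈ ξ ↔ ∃ w, ∃ X ∈ D.slice ξ w, Rel X p.1 w w := by
  constructor
  · intro hp
    rcases bot_or_idem p with rfl | ⟨u, C, hC, hC0, rfl⟩
    · exact (hξ.bot_notMem hp).elim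
    · exact ⟨u, C, ⟨hC, hC0, hp⟩, (rel_idem_iff _ _).2 ⟨[], by simp, le_rfl⟩⟩
  · rintro ⟨w, X, ⟨hX, hX0, hm⟩, hr⟩
    exact hξ.up _ _ hm ((idem_le_iff_rel _ _ _).2 hr)

/-- Upward closure of the filter read on slices. The element `C` is nonzero because `θ_v` preserves
`⊥`. -/
theorem slice_up (hξ : IsPosetFilter ξ) {w v : List L} {A C : B} (hA : A ∈ D.slice ξ (w ++ v))
    (hC : C ∈ D.ideal w) (hle : A ≤ D.act v C) : C ∈ D.slice ξ w := by
  obtain ⟨hA, hA0, hm⟩ := hA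
  have hC0 : C ≠ ⊥ := by
    rintro rfl
    rw [act_bot, le_bot_iff] at hle
    exact hA0 hle
  exact ⟨hC, hC0, hξ.up _ _ hm ((idem_le_idem _ _ _ _).2 ⟨v, rfl, hle⟩)⟩

theorem slice_mono (hξ : IsPosetFilter ξ) {w : List L} {A C : B} (hA : A ∈ D.slice ξ w)
    (hC : C ∈ D.ideal w) (hle : A ≤ C) : C ∈ D.slice ξ w :=
  slice_up hξ (v := []) (by rwa [List.append_nil]) hC hle

/-- A common lower bound in the filter has a word `wvy` and an entry below both `θ_{vy}(A)` and
`θ_y(C)`, hence below `θ_y(θ_v(A) ⊓ C)`; upward closure then removes `y`. -/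
theorem slice_inf (hξ : IsPosetFilter ξ) {w v : List L} {A C : B} (hA : A ∈ D.slice ξ w)
    (hC : C ∈ D.slice ξ (w ++ v)) : D.act v A ⊓ C ∈ D.slice ξ (w ++ v) := by
  obtain ⟨hA, hA0, hm⟩ := hA
  obtain ⟨hC, hC0, hm'⟩ := hC
  obtain ⟨z, hz, hz1, hz2⟩ := hξ.directed _ _ hm hm'
  rcases bot_or_idem z with rfl | ⟨x, X, hX, hX0, rfl⟩
  · exact (hξ.bot_notMem hz).elim
  obtain ⟨y, rfl, hXC⟩ := (idem_le_idem _ _ _ _).1 hz2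
  obtain ⟨y', hy', hXA⟩ := (idem_le_idem _ _ _ _).1 hz1
  rw [List.append_assoc] at hy'
  obtain rfl := List.append_cancel_left hy'
  refine slice_up hξ (v := y) ⟨hX, hX0, hz⟩ (D.ideal_lower inf_le_right hC) ?_
  rw [act_inf, ← act_append]
  exact le_inf hXA hXC

/-- Both words are beginnings of the word of a common lower bound in the filter. -/
theorem slice_comparable (hξ : IsPosetFilter ξ) {w w' : List L} (h : (D.slice ξ w).Nonempty)
    (h' : (D.slice ξ w').Nonempty) (hl : w.length ≤ w'.length) : ∃ v, w' = w ++ v := by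
  obtain ⟨A, hA, hA0, hm⟩ := h
  obtain ⟨C, hC, hC0, hm'⟩ := h'
  obtain ⟨z, hz, hz1, hz2⟩ := hξ.directed _ _ hm hm'
  rcases bot_or_idem z with rfl | ⟨x, X, hX, hX0, rfl⟩
  · exact (hξ.bot_notMem hz).elim
  obtain ⟨y, rfl, -⟩ := (idem_le_idem _ _ _ _).1 hz1
  obtain ⟨y', hy', -⟩ := (idem_le_idem _ _ _ _).1 hz2
  exact Word.IsBeginning.exists_append (γ := .fin (w ++ y)) ⟨.fin y, by rw [Word.append_fin]⟩
    ⟨.fin y', by rw [Word.append_fin, hy']⟩ hl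

theorem exists_slice_nonempty (hξ : IsPosetFilter ξ) : ∃ w, (D.slice ξ w).Nonempty := by
  obtain ⟨p, hp⟩ := hξ.nonempty
  obtain ⟨w, X, hX, _⟩ := (mem_filter_iff hξ p).1 hp
  exact ⟨w, X, hX⟩

end slices

/-! ### The word of a filter -/

theorem ideal_ne_bot_of_mem {w : List L} {A : B} (h : A ∈ D.ideal w) (hA : A ≠ ⊥) :
    D.ideal w ≠ {⊥} := by
  intro h1
  rw [h1] at h
  exact hA h

/-- For nonempty `u`, membership in `I_{uv}` bounds `A` by `θ_v(Y)` for some `Y ∈ I_u`, and `Y = ⊥`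
would force `A = ⊥`. -/
theorem ideal_prefix_ne_bot {u v : List L} {A : B} (h : A ∈ D.ideal (u ++ v)) (hA : A ≠ ⊥) :
    D.ideal u ≠ {⊥} := by
  cases u with
  | nil => exact ideal_ne_bot_of_mem (A := A) trivial hA
  | cons a u =>
    obtain ⟨X, hX, hle⟩ := h
    change A ≤ D.act (u ++ v) X at hle
    rw [act_append] at hle
    refine ideal_ne_bot_of_mem (A := D.act u X) ⟨X, hX, le_rfl⟩ ?_
    intro h0
    rw [h0, act_bot, le_bot_iff] at hle
    exact hA hle

/-- Membership in `W^{≤∞}` comes for free: a nonempty slice at a long enough beginning makes the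
ideals of all shorter beginnings nonzero. -/
theorem isWordOf_of {ξ : Set (Idem (Semi D))} {α : Word L}
    (h1 : ∀ w, (D.slice ξ w).Nonempty → Word.IsBeginning w α)
    (h2 : ∀ n : ℕ, (n : ℕ∞) ≤ α.length → ∃ w, n ≤ w.length ∧ (D.slice ξ w).Nonempty) :
    D.IsWordOf ξ α := by
  refine ⟨?_, h1, h2⟩
  have key : ∀ n : ℕ, (n : ℕ∞) ≤ α.length → D.ideal (α.take n) ≠ {⊥} := by
    intro n hn
    obtain ⟨w, hw, A, hA, hA0, hm⟩ := h2 n hn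
    obtain ⟨v, rfl⟩ := (Word.isBeginning_take α n).exists_append (h1 w ⟨A, hA, hA0, hm⟩)
      (by rwa [Word.length_take_of_le hn])
    exact ideal_prefix_ne_bot hA hA0
  cases α with
  | fin w =>
    have := key w.length le_rfl
    rwa [Word.take, List.take_length] at this
  | inf x => exact fun n _ => key n le_top

/-- The words with nonempty slice form a chain of beginnings. If their lengths are bounded, the
longest one is the word of `ξ`; otherwise their union is an infinite word. -/
theorem exists_isWordOf {ξ : Set (Idem (Semi D))} (hξ : IsPosetFilter ξ) :
    ∃ α, D.IsWordOf ξ α := by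
  by_cases hb : ∃ N, ∀ w, (D.slice ξ w).Nonempty → w.length ≤ N
  · obtain ⟨w₀, hw₀⟩ := exists_slice_nonempty hξ
    obtain ⟨w, hw, hmax⟩ : ∃ w, (D.slice ξ w).Nonempty ∧
        ∀ w', (D.slice ξ w').Nonempty → w'.length ≤ w.length := by
      by_contra! hcon
      have : ∀ n, ∃ w, (D.slice ξ w).Nonempty ∧ n ≤ w.length := by
        intro n
        induction n with
        | zero => exact ⟨w₀, hw₀, Nat.zero_le _⟩
        | succ n ih =>
          obtain ⟨w, hw, hn⟩ := ih
          obtain ⟨w', hw', hlt⟩ := hcon w hw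
          exact ⟨w', hw', by omega⟩
      obtain ⟨N, hN⟩ := hb
      obtain ⟨w, hw, hn⟩ := this (N + 1)
      have := hN w hw
      omega
    refine ⟨.fin w, isWordOf_of ?_ ?_⟩
    · intro w' hw'
      obtain ⟨v, rfl⟩ := slice_comparable hξ hw' hw (hmax w' hw')
      exact ⟨.fin v, by rw [Word.append_fin]⟩
    · intro n hn
      exact ⟨w, Nat.cast_le.1 hn, hw⟩
  · push Not at hb
    -- Since `f n` has more than `n` letters, letter `n` of the infinite word can be read off `f n`;
    -- comparability makes this independent of the choice of `f`.
    choose f hf hlen using hb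
    have key : ∀ w, (D.slice ξ w).Nonempty →
        Word.take w.length (.inf fun n => (f n)[n]'(hlen n)) = w := by
      intro w hw
      apply List.ext_getElem
      · exact Word.length_take_of_le le_top
      · intro i h1 h2
        have hget : (Word.take w.length (.inf fun n => (f n)[n]'(hlen n)))[i] =
            (f i)[i]'(hlen i) := by
          apply Option.some_injective
          rw [← List.getElem?_eq_getElem]
          exact Stream'.getElem?_take h2
        rw [hget]
        rcases le_total w.length (f i).length with hl | hl
        · obtain ⟨v, hv⟩ := slice_comparable hξ hw (hf i) hl
          simp only [hv, List.getElem_append_left h2]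
        · obtain ⟨v, hv⟩ := slice_comparable hξ (hf i) hw hl
          simp only [hv, List.getElem_append_left (hlen i)]
    refine ⟨.inf fun n => (f n)[n]'(hlen n), isWordOf_of ?_ ?_⟩
    · intro w hw
      have := Word.isBeginning_take (.inf fun n => (f n)[n]'(hlen n)) w.length
      rwa [key w hw] at this
    · intro n _
      exact ⟨f n, (hlen n).le, hf n⟩

/-! ### The standard action on tight characters -/

/-- Turns the domain condition of a germ into the slice condition used in the next two lemmas. -/
theorem dom_tri {β γ : List L} {A : B} (hβ : A ∈ D.ideal β) (hγ : A ∈ D.ideal γ) (hA : A ≠ ⊥) :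
    dom (tri β A γ hβ hγ hA) = idem γ A hγ hA := by
  apply Subtype.ext
  apply rel_ext
  intro C hC x y
  change Rel C (mul (Semi.inv (tri β A γ hβ hγ hA)) (tri β A γ hβ hγ hA)) x y ↔
    Rel C (tri γ A γ hγ hγ hA) x y
  simp only [rel_mul _ _ hC, rel_inv]
  constructor
  · rintro ⟨z, ⟨w, rfl, rfl, h1⟩, w', h2, rfl, h3⟩
    obtain rfl := List.append_cancel_left h2
    exact ⟨w, rfl, rfl, h1⟩
  · rintro ⟨w, rfl, rfl, h1⟩
    exact ⟨_, ⟨w, rfl, rfl, h1⟩, w, rfl, rfl, h1⟩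

theorem mem_slice_of_dom {β γ : List L} {A : B} {hβ : A ∈ D.ideal β} {hγ : A ∈ D.ideal γ}
    {hA : A ≠ ⊥} {φ : TightChar (Semi D)} (h : φ.1 (dom (tri β A γ hβ hγ hA)) = true) :
    A ∈ D.slice φ.toFilter.1 γ := by
  rw [dom_tri] at h
  exact ⟨hγ, hA, h⟩

theorem dom_of_mem_slice {β γ : List L} {A : B} (hβ : A ∈ D.ideal β) {hγ : A ∈ D.ideal γ}
    {hA : A ≠ ⊥} {φ : TightChar (Semi D)} (h : A ∈ D.slice φ.toFilter.1 γ) :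
    φ.1 (dom (tri β A γ hβ hγ hA)) = true := by
  rw [dom_tri]
  exact h.2.2

/-- As a partial bijection, `s⋆ p s` takes `γu` to `βu`, applies `p`, and returns. -/
theorem rel_conj_tri {β γ : List L} {A : B} (hβ : A ∈ D.ideal β) (hγ : A ∈ D.ideal γ)
    (hA : A ≠ ⊥) (p : Idem (Semi D)) {X : B} (hX : X ≠ ⊥) (x : List L) :
    Rel X (conj (tri β A γ hβ hγ hA) p).1 x x ↔
      ∃ u, x = γ ++ u ∧ X ≤ D.act u A ∧ Rel X p.1 (β ++ u) (β ++ u) := by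
  change Rel X (mul (mul (Semi.inv (tri β A γ hβ hγ hA)) p.1) (tri β A γ hβ hγ hA)) x x ↔ _
  simp only [rel_mul _ _ hX, rel_inv]
  constructor
  · rintro ⟨z, ⟨w, ⟨u, rfl, rfl, h1⟩, h2⟩, u', rfl, h3, h4⟩
    obtain rfl := List.append_cancel_left h3
    exact ⟨u, rfl, h1, h2⟩
  · rintro ⟨u, rfl, h1, h2⟩
    exact ⟨_, ⟨_, ⟨u, rfl, rfl, h1⟩, h2⟩, u, rfl, rfl, h1⟩

theorem mem_act {β γ : List L} {A : B} {hβ : A ∈ D.ideal β} {hγ : A ∈ D.ideal γ}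
    {hA : A ≠ ⊥} {φ : TightChar (Semi D)} (h : φ.1 (dom (tri β A γ hβ hγ hA)) = true)
    (p : Idem (Semi D)) :
    p ∈ (TightChar.act _ φ h).toFilter.1 ↔
      ∃ u, ∃ X ∈ D.slice φ.toFilter.1 (γ ++ u), X ≤ D.act u A ∧ Rel X p.1 (β ++ u) (β ++ u) := by
  change conj (tri β A γ hβ hγ hA) p ∈ φ.toFilter.1 ↔ _
  rw [mem_filter_iff φ.toFilter.2.1]
  constructor
  · rintro ⟨w, X, hX, hr⟩
    obtain ⟨u, rfl, h1, h2⟩ := (rel_conj_tri hβ hγ hA p hX.2.1 w).1 hr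
    exact ⟨u, X, hX, h1, h2⟩
  · rintro ⟨u, X, hX, h1, h2⟩
    exact ⟨_, X, hX, (rel_conj_tri hβ hγ hA p hX.2.1 _).2 ⟨u, rfl, h1, h2⟩⟩

/-- The element replaces the beginning `γ` by `β` and keeps the tail `v`, so slices are transported
unchanged up to closure inside the new ideal. -/
theorem slice_act_append {β γ : List L} {A : B} {hβ : A ∈ D.ideal β} {hγ : A ∈ D.ideal γ}
    {hA : A ≠ ⊥} {φ : TightChar (Semi D)} (h : φ.1 (dom (tri β A γ hβ hγ hA)) = true)
    (v : List L) (C : B) :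
    C ∈ D.slice (TightChar.act _ φ h).toFilter.1 (β ++ v) ↔
      C ∈ D.ideal (β ++ v) ∧ ∃ X ∈ D.slice φ.toFilter.1 (γ ++ v), X ≤ C := by
  constructor
  · rintro ⟨hC, hC0, hm⟩
    refine ⟨hC, ?_⟩
    obtain ⟨u, X, hX, h1, h2⟩ := (mem_act h _).1 hm
    obtain ⟨u', h3, h4⟩ := (rel_idem_iff _ _).1 h2
    rw [List.append_assoc] at h3
    obtain rfl := List.append_cancel_left h3
    rw [← List.append_assoc] at hX
    -- `C` itself need not lie in `I_{γv}`; meeting it with `θ_v(A)` puts it there and keeps it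
    -- above `X` after the remaining letters.
    refine ⟨D.act v A ⊓ C, slice_up φ.toFilter.2.1 hX
      (D.ideal_lower inf_le_left (D.act_mem_ideal v hγ)) ?_, inf_le_right⟩
    rw [act_append] at h1
    rw [act_inf]
    exact le_inf h1 h4
  · rintro ⟨hC, X, hX, hXC⟩
    have hC0 : C ≠ ⊥ := by
      rintro rfl
      exact hX.2.1 (le_bot_iff.1 hXC)
    refine ⟨hC, hC0, (mem_act h _).2 ⟨v, D.act v A ⊓ X, ?_, inf_le_left,
      (rel_idem_iff _ _).2 ⟨[], by simp, inf_le_right.trans hXC⟩⟩⟩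
    exact slice_inf φ.toFilter.2.1 (mem_slice_of_dom h) hX

/-- Covers the words shorter than `β = wv`, to which `slice_act_append` does not apply. It is the
closed form of the downward recursion in the gluing map. -/
theorem slice_act_prefix {w v γ : List L} {A : B} {hβ : A ∈ D.ideal (w ++ v)}
    {hγ : A ∈ D.ideal γ}
    {hA : A ≠ ⊥} {φ : TightChar (Semi D)} (h : φ.1 (dom (tri (w ++ v) A γ hβ hγ hA)) = true)
    (C : B) :
    C ∈ D.slice (TightChar.act _ φ h).toFilter.1 w ↔
      C ∈ D.ideal w ∧ ∃ X ∈ D.slice φ.toFilter.1 γ, X ≤ D.act v C := by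
  constructor
  · rintro ⟨hC, hC0, hm⟩
    refine ⟨hC, ?_⟩
    obtain ⟨u, X, hX, h1, h2⟩ := (mem_act h _).1 hm
    obtain ⟨u', h3, h4⟩ := (rel_idem_iff _ _).1 h2
    rw [List.append_assoc] at h3
    obtain rfl := List.append_cancel_left h3
    refine ⟨A ⊓ D.act v C, slice_up φ.toFilter.2.1 hX (D.ideal_lower inf_le_left hγ) ?_,
      inf_le_right⟩
    rw [act_append] at h4
    rw [act_inf]
    exact le_inf h1 h4
  · rintro ⟨hC, X, hX, hXC⟩
    have hC0 : C ≠ ⊥ := by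
      rintro rfl
      rw [act_bot] at hXC
      exact hX.2.1 (le_bot_iff.1 hXC)
    refine ⟨hC, hC0, (mem_act h _).2 ⟨[], A ⊓ X, ?_, inf_le_left,
      (rel_idem_iff _ _).2 ⟨v, by simp, inf_le_right.trans hXC⟩⟩⟩
    exact slice_inf (v := []) φ.toFilter.2.1 (mem_slice_of_dom h) (by simpa using hX)

theorem mem_slice_act {β γ : List L} {A : B} {hβ : A ∈ D.ideal β} {hγ : A ∈ D.ideal γ}
    {hA : A ≠ ⊥} {φ : TightChar (Semi D)} (h : φ.1 (dom (tri β A γ hβ hγ hA)) = true) :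
    A ∈ D.slice (TightChar.act _ φ h).toFilter.1 β := by
  have h1 := (slice_act_append h [] A).2
  simp only [List.append_nil] at h1
  exact h1 ⟨hβ, A, mem_slice_of_dom h, le_rfl⟩

/-- The element `(β, A, γ)` carries filters with word `γα'` to filters with word `βα'`. -/
theorem isWordOf_act {β γ : List L} {A : B} {hβ : A ∈ D.ideal β} {hγ : A ∈ D.ideal γ}
    {hA : A ≠ ⊥} {φ : TightChar (Semi D)} (h : φ.1 (dom (tri β A γ hβ hγ hA)) = true)
    {α' : Word L} (hw : D.IsWordOf φ.toFilter.1 (Word.append γ α')) :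
    D.IsWordOf (TightChar.act _ φ h).toFilter.1 (Word.append β α') := by
  apply isWordOf_of
  · rintro w ⟨C, hC, hC0, hm⟩
    obtain ⟨u, X, hX, -, h2⟩ := (mem_act h _).1 hm
    obtain ⟨u', h3, -⟩ := (rel_idem_iff _ _).1 h2
    obtain ⟨δ, rfl⟩ := Word.isBeginning_append_iff.1 (hw.isBeginning _ ⟨X, hX⟩)
    exact ⟨Word.append u' δ, by rw [← Word.append_append, h3, Word.append_append]⟩
  · intro n hn
    rcases le_total n β.length with hl | hl
    · exact ⟨β, hl, A, mem_slice_act h⟩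
    · obtain ⟨m, rfl⟩ := Nat.exists_eq_add_of_le hl
      rw [Word.length_append, Nat.cast_add] at hn
      have hm := (ENat.add_le_add_iff_left (ENat.natCast_ne_top _)).1 hn
      -- A slice `m` letters beyond `γ` is transported to one `m` letters beyond `β`.
      obtain ⟨w, hwl, hne⟩ := hw.cofinal (γ.length + m) (by
        rw [Word.length_append, Nat.cast_add]
        exact add_le_add_right hm _)
      obtain ⟨v, rfl⟩ := Word.IsBeginning.exists_append (γ := Word.append γ α') ⟨α', rfl⟩
        (hw.isBeginning w hne) (by omega)
      obtain ⟨X, hX⟩ := hne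
      refine ⟨β ++ v, by simp at hwl ⊢; omega, D.act v A ⊓ X, ?_⟩
      rw [slice_act_append h]
      exact ⟨D.ideal_lower inf_le_left (D.act_mem_ideal v hβ), _,
        slice_inf φ.toFilter.2.1 (mem_slice_of_dom h) hX, le_rfl⟩

/-! ### Cutting as an action -/

theorem filter_ext {ξ η : Set (Idem (Semi D))} (hξ : ⊥ ∉ ξ) (hη : ⊥ ∉ η)
    (h : ∀ w A (hw : A ∈ D.ideal w) (hA : A ≠ ⊥), idem w A hw hA ∈ ξ ↔ idem w A hw hA ∈ η) :
    ξ = η := by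
  ext p
  rcases bot_or_idem p with rfl | ⟨w, A, hw, hA, rfl⟩
  · exact iff_of_false hξ hη
  · exact h w A hw hA

/-- Cutting is the action of `(∅, A, γ)`. -/
theorem toFilter_act_eq_cut {γ : List L} {A : B} {h₀ : A ∈ D.ideal []} {hγ : A ∈ D.ideal γ}
    {hA : A ≠ ⊥} {φ : TightChar (Semi D)} (h : φ.1 (dom (tri [] A γ h₀ hγ hA)) = true)
    {α' : Word L} (hw : D.IsWordOf φ.toFilter.1 (Word.append γ α')) :
    (TightChar.act _ φ h).toFilter.1 = D.cut γ α' φ.toFilter.1 := by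
  apply filter_ext (TightChar.toFilter _).2.1.bot_notMem (bot_notMem_cut φ.toFilter.2.1 _ _)
  intro w C hC hC0
  rw [mem_cut φ.toFilter.2.1 hw]
  -- With empty left word this is the description in `mem_cut`, except for the condition that `w`
  -- begins `α'`, which `isWordOf_act` supplies.
  have h1 := slice_act_append h w C
  rw [List.nil_append] at h1
  constructor
  · intro hm
    have h2 := h1.1 ⟨hC, hC0, hm⟩
    refine ⟨?_, h2.2⟩
    exact (isWordOf_act h hw).isBeginning w ⟨C, hC, hC0, hm⟩
  · rintro ⟨_, hX⟩
    exact (h1.2 ⟨hC, hX⟩).2.2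

/-! ### Gluing as an action -/

theorem glueTop_eq (α : List L) (γ : Word L) :
    (γ = .fin [] ∧ glueTop α γ = α.length) ∨ (γ ≠ .fin [] ∧ glueTop α γ = α.length + 1) := by
  cases γ with
  | fin w => cases w <;> simp [glueTop]
  | inf x => simp [glueTop]

/-- For nonempty `u`, an element of `I_{uv}` is by definition below `θ_v` of an element of `I_u`.
For empty `u` there is no such bound, and the slice at the empty word may be empty. -/
theorem slice_prefix_nonempty {ξ : Set (Idem (Semi D))} (hξ : IsPosetFilter ξ) {u v : List L}
    (hu : u ≠ []) (h : (D.slice ξ (u ++ v)).Nonempty) : (D.slice ξ u).Nonempty := by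
  obtain ⟨A, hA⟩ := h
  cases u with
  | nil => exact absurd rfl hu
  | cons a u =>
    obtain ⟨X, hX, hle⟩ := hA.1
    change A ≤ D.act (u ++ v) X at hle
    rw [act_append] at hle
    exact ⟨D.act u X, slice_up hξ hA ⟨X, hX, le_rfl⟩ hle⟩

theorem act_mem_ideal_self (v : List L) (C : B) : D.act v C ∈ D.ideal v :=
  D.act_mem_ideal (u := []) v (Set.mem_univ C)

/-- Shows that the recursion step of gluing across the first letter of `γ` recovers `ξ_0`.
Nonemptiness at `v` is needed to move `C` forward: `θ_v(C)` is reached as an upper bound of its meet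
with an element already in the slice. -/
theorem mem_slice_nil_iff_act {ξ : Set (Idem (Semi D))} (hξ : IsPosetFilter ξ) {v : List L}
    (hv : (D.slice ξ v).Nonempty) (C : B) :
    C ∈ D.slice ξ [] ↔ D.act v C ∈ D.slice ξ v := by
  constructor
  · intro hC
    obtain ⟨X, hX⟩ := hv
    exact slice_mono hξ (slice_inf (v := v) hξ hC hX) (act_mem_ideal_self v C) inf_le_left
  · intro hC
    exact slice_up (v := v) hξ hC (Set.mem_univ C) le_rfl

theorem slice_take_one_nonempty {ξ : Set (Idem (Semi D))} (hξ : IsPosetFilter ξ) {γ : Word L}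
    (hw : D.IsWordOf ξ γ) (hγ : γ ≠ .fin []) : (D.slice ξ (γ.take 1)).Nonempty := by
  have hl : ((1 : ℕ) : ℕ∞) ≤ γ.length := by
    cases γ with
    | fin w =>
      cases w with
      | nil => exact absurd rfl hγ
      | cons a w => exact Nat.cast_le.2 (by simp)
    | inf x => exact le_top
  have h1 := Word.length_take_of_le hl
  obtain ⟨w, hwl, hne⟩ := hw.cofinal 1 hl
  obtain ⟨v, rfl⟩ := (Word.isBeginning_take γ 1).exists_append (hw.isBeginning w hne)
    (by rwa [h1])
  refine slice_prefix_nonempty hξ (fun h0 => ?_) hne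
  rw [h0] at h1
  simp at h1

/-- If `γ` is empty, the index `|β|` is already at the top `N` and is read directly. Otherwise `N =
|β| + 1`, and one recursion step tests `C` through `θ_{γ_1}`, which is equivalent to membership in
`ξ_0`. -/
theorem mem_glueFamily_length {ξ : Set (Idem (Semi D))} (hξ : IsPosetFilter ξ) {γ : Word L}
    (hw : D.IsWordOf ξ γ) (β : List L) (C : B) :
    C ∈ D.glueFamily β γ ξ β.length ↔ C ∈ D.ideal β ∧ C ∈ D.slice ξ [] := by
  rw [glueFamily]
  rcases glueTop_eq β γ with ⟨rfl, h⟩ | ⟨hγ, h⟩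
  · rw [if_neg (by omega), Word.take_length_append, Nat.sub_self, Word.take_zero]
    exact and_comm
  · have h1 := Word.take_append β γ 1
    rw [if_pos (by omega), Word.take_length_append, h1, List.drop_left, glueFamily,
      if_neg (by omega), h1, Nat.add_sub_cancel_left]
    refine and_congr_right fun hC => ?_
    rw [mem_slice_nil_iff_act hξ (slice_take_one_nonempty hξ hw hγ)]
    exact ⟨fun h2 => h2.1, fun h2 => ⟨h2, D.act_mem_ideal _ hC⟩⟩

/-- Unrolls the downward recursion: the one-letter maps compose to `θ_v`, and the intermediate ideal
conditions follow from `C ∈ I_u`. -/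
theorem mem_glueFamily_prefix {ξ : Set (Idem (Semi D))} (hξ : IsPosetFilter ξ) {γ : Word L}
    (hw : D.IsWordOf ξ γ) {β : List L} (v : List L) : ∀ (u : List L), β = u ++ v → ∀ C : B,
    (C ∈ D.glueFamily β γ ξ u.length ↔ C ∈ D.ideal u ∧ D.act v C ∈ D.slice ξ []) := by
  induction v with
  | nil =>
    rintro u rfl C
    rw [List.append_nil]
    exact mem_glueFamily_length hξ hw u C
  | cons a v ih =>
    rintro u rfl C
    have h1 := ih (u ++ [a]) (by simp) (D.θ a C)
    have h2 : (Word.append (u ++ a :: v) γ).take (u.length + 1) = u ++ [a] := by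
      have := Word.take_length_append (u ++ [a]) (Word.append v γ)
      rw [← Word.append_append] at this
      simpa using this
    have h3 : (Word.append (u ++ a :: v) γ).take u.length = u := by
      rw [Word.append_append, Word.take_length_append]
    have h4 : u.length < glueTop (u ++ a :: v) γ := by
      rcases glueTop_eq (u ++ a :: v) γ with ⟨_, h⟩ | ⟨_, h⟩ <;> rw [h] <;> simp
    rw [glueFamily, if_pos h4, h2, h3, List.drop_left]
    rw [List.length_append, List.length_singleton] at h1
    refine and_congr_right fun hC => ?_
    exact h1.trans ⟨fun h => h.2, fun h => ⟨D.act_mem_ideal [a] hC, h⟩⟩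

/-- Up to index `|β|`, both sides test `θ_v(C)` against `ξ_0`. Beyond it the recursion is over, and
the upward closure in `slice_act_append` adds nothing, since `I_{βw} ⊆ I_w` and slices are upward
closed in `I_w`. -/
theorem glueFamily_eq_slice_act {β : List L} {A : B} {hβ : A ∈ D.ideal β} {h₀ : A ∈ D.ideal []}
    {hA : A ≠ ⊥} {φ : TightChar (Semi D)} (h : φ.1 (dom (tri β A [] hβ h₀ hA)) = true)
    {γ : Word L} (hw : D.IsWordOf φ.toFilter.1 γ) (n : ℕ) :
    D.glueFamily β γ φ.toFilter.1 n =
      D.slice (TightChar.act _ φ h).toFilter.1 ((Word.append β γ).take n) := by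
  ext C
  rcases le_or_gt n β.length with hn | hn
  · obtain ⟨u, v, rfl, rfl⟩ : ∃ u v, β = u ++ v ∧ u.length = n :=
      ⟨β.take n, β.drop n, by simp, by simpa using hn⟩
    have h3 : (Word.append (u ++ v) γ).take u.length = u := by
      rw [Word.append_append, Word.take_length_append]
    rw [h3, slice_act_prefix h, mem_glueFamily_prefix φ.toFilter.2.1 hw v u rfl]
    refine and_congr_right fun _ => ⟨fun h1 => ⟨_, h1, le_rfl⟩, ?_⟩
    rintro ⟨X, hX, hle⟩
    exact slice_mono φ.toFilter.2.1 hX (Set.mem_univ _) hle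
  · obtain ⟨m, rfl⟩ := Nat.exists_eq_add_of_le hn.le
    rw [Word.take_append, slice_act_append h, glueFamily, if_neg, Nat.add_sub_cancel_left,
      Word.take_append, List.nil_append]
    · constructor
      · rintro ⟨h1, h2⟩
        exact ⟨h2, C, h1, le_rfl⟩
      · rintro ⟨h1, X, hX, hle⟩
        exact ⟨slice_mono φ.toFilter.2.1 hX (D.ideal_append_subset β _ h1) hle, h1⟩
    · rcases glueTop_eq β γ with ⟨_, h⟩ | ⟨_, h⟩ <;> omega

/-- Gluing is the action of `(β, A, ∅)`. -/
theorem toFilter_act_eq_glue {β : List L} {A : B} {hβ : A ∈ D.ideal β} {h₀ : A ∈ D.ideal []}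
    {hA : A ≠ ⊥} {φ : TightChar (Semi D)} (h : φ.1 (dom (tri β A [] hβ h₀ hA)) = true)
    {γ : Word L} (hw : D.IsWordOf φ.toFilter.1 γ) :
    (TightChar.act _ φ h).toFilter.1 = D.glue β γ φ.toFilter.1 := by
  cases β with
  -- For the empty word, cutting and gluing are both the identity.
  | nil => exact toFilter_act_eq_cut h (α' := γ) hw
  | cons a u =>
    have hfil := (TightChar.act _ φ h).toFilter.2.1
    apply Set.Subset.antisymm
    · intro p hp
      rcases bot_or_idem p with rfl | ⟨w, C, hC, hC0, rfl⟩
      · exact (hfil.bot_notMem hp).elim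
      have hb := (isWordOf_act h (α' := γ) hw).isBeginning w ⟨C, hC, hC0, hp⟩
      have ht := hb.take_eq
      refine ⟨w.length, hb.le_length, C, ?_, by rwa [ht], hC0, ?_⟩
      · rw [glueFamily_eq_slice_act h hw, ht]
        exact ⟨hC, hC0, hp⟩
      · exact (idem_le_idem _ _ _ _).2 ⟨[], by rw [ht]; simp, le_rfl⟩
    · rintro p ⟨n, hn, C, hC, _, _, hle⟩
      rw [glueFamily_eq_slice_act h hw] at hC
      exact hfil.up _ _ hC.2.2 hle

end GBDS

theorem TightChar.act_eq_of_eq {S : Type u} [InverseSemigroupWithZero S] {s t : S}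
    {φ : TightChar S} (h : s = t) (hs : φ.1 (dom s) = true) (ht : φ.1 (dom t) = true) :
    TightChar.act s φ hs = TightChar.act t φ ht := by
  subst h
  rfl

theorem TightChar.act_idem {S : Type u} [InverseSemigroupWithZero S] (e : Idem S)
    (φ : TightChar S) (h : φ.1 (dom e.1) = true) : TightChar.act e.1 φ h = φ := by
  have he : dom e.1 = e := by
    apply Subtype.ext
    change star e.1 * e.1 = e.1
    rw [star_idem e.2, e.2]
  apply Subtype.ext
  funext x
  change φ.1 (conj e.1 x) = φ.1 x
  have h1 : conj e.1 x = e ⊓ (x ⊓ e) := by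
    apply Subtype.ext
    change star e.1 * x.1 * e.1 = e.1 * (x.1 * e.1)
    rw [star_idem e.2, mul_assoc]
  rw [he] at h
  rw [h1, φ.2.map_inf, φ.2.map_inf, h]
  simp

namespace GBDS

variable {B : Type u} [GeneralizedBooleanAlgebra B] {L : Type v} {D : GBDS B L}

open Semi

/-! ### Products of triples -/

theorem tri_mul_tri {α β γ : List L} {A : B} (hα : A ∈ D.ideal α) (hβ : A ∈ D.ideal β)
    (hγ : A ∈ D.ideal γ) (hA : A ≠ ⊥) :
    tri α A β hα hβ hA * tri β A γ hβ hγ hA = tri α A γ hα hγ hA := by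
  apply rel_ext
  intro C hC x y
  change Rel C (mul (tri α A β hα hβ hA) (tri β A γ hβ hγ hA)) x y ↔ _
  rw [rel_mul _ _ hC]
  constructor
  · rintro ⟨z, ⟨w, rfl, rfl, h1⟩, w', h2, rfl, h3⟩
    obtain rfl := List.append_cancel_left h2
    exact ⟨w, rfl, rfl, h1⟩
  · rintro ⟨w, rfl, rfl, h1⟩
    exact ⟨_, ⟨w, rfl, rfl, h1⟩, w, rfl, rfl, h1⟩

/-- With `β = []` this factors the action of a triple into a cut followed by a gluing. -/
theorem act_act_tri {α β γ : List L} {A : B} {hα : A ∈ D.ideal α} {hβ : A ∈ D.ideal β}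
    {hγ : A ∈ D.ideal γ} {hA : A ≠ ⊥} {φ : TightChar (Semi D)}
    (h : φ.1 (dom (tri β A γ hβ hγ hA)) = true)
    (h' : (TightChar.act _ φ h).1 (dom (tri α A β hα hβ hA)) = true)
    (h'' : φ.1 (dom (tri α A γ hα hγ hA)) = true) :
    TightChar.act _ (TightChar.act _ φ h) h' = TightChar.act _ φ h'' := by
  have he := tri_mul_tri hα hβ hγ hA
  have hm : φ.1 (dom (tri α A β hα hβ hA * tri β A γ hβ hγ hA)) = true := by
    rw [he]
    exact h''
  rw [← TightGroupoid.act_act _ _ φ h h' hm]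
  exact TightChar.act_eq_of_eq he _ _

theorem act_tri_self {α : List L} {A : B} {hα : A ∈ D.ideal α} {hA : A ≠ ⊥}
    {φ : TightChar (Semi D)} (h : φ.1 (dom (tri α A α hα hα hA)) = true) :
    TightChar.act _ φ h = φ :=
  TightChar.act_idem (idem α A hα hA) φ h

theorem dom_act_tri {α β γ : List L} {A : B} (hα : A ∈ D.ideal α) {hβ : A ∈ D.ideal β}
    {hγ : A ∈ D.ideal γ} {hA : A ≠ ⊥} {φ : TightChar (Semi D)}
    (h : φ.1 (dom (tri β A γ hβ hγ hA)) = true) :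
    (TightChar.act _ φ h).1 (dom (tri α A β hα hβ hA)) = true :=
  dom_of_mem_slice hα (mem_slice_act h)

/-- The filters of `φ` and of `(β, A, γ) φ` have the same cuts. -/
theorem cut_act_eq_cut {β γ : List L} {A : B} {hβ : A ∈ D.ideal β} {hγ : A ∈ D.ideal γ}
    {hA : A ≠ ⊥} {φ : TightChar (Semi D)} (h : φ.1 (dom (tri β A γ hβ hγ hA)) = true)
    {α' : Word L} (hw : D.IsWordOf φ.toFilter.1 (Word.append γ α')) :
    D.cut β α' (TightChar.act _ φ h).toFilter.1 = D.cut γ α' φ.toFilter.1 := by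
  have h₀ : A ∈ D.ideal [] := Set.mem_univ A
  have h1 := dom_of_mem_slice (hγ := hγ) (hA := hA) h₀ (mem_slice_of_dom h)
  -- Both cuts are actions of triples with empty left word, and `(∅, A, β)(β, A, γ) = (∅, A, γ)`.
  rw [← toFilter_act_eq_cut (dom_act_tri h₀ h) (isWordOf_act h hw), ← toFilter_act_eq_cut h1 hw,
    act_act_tri h _ h1]

theorem exists_isWordOf_append {β γ : List L} {A : B} {hβ : A ∈ D.ideal β} {hγ : A ∈ D.ideal γ}
    {hA : A ≠ ⊥} {φ : TightChar (Semi D)} (h : φ.1 (dom (tri β A γ hβ hγ hA)) = true) :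
    ∃ α', D.IsWordOf φ.toFilter.1 (Word.append γ α') := by
  obtain ⟨α, hα⟩ := exists_isWordOf φ.toFilter.2.1
  obtain ⟨α', rfl⟩ := hα.isBeginning γ ⟨A, mem_slice_of_dom h⟩
  exact ⟨α', hα⟩

/-! ### The degree -/

/-- The degree `|α| - |β|` of `(α, A, β)`. -/
def Semi.degree : Semi D → ℤ
  | zero => 0
  | tri α _ β _ _ _ => (α.length : ℤ) - β.length

theorem Semi.degree_eq_of_rel {s : Semi D} {C : B} {x y : List L} (h : Rel C s x y) :
    s.degree = (x.length : ℤ) - y.length := by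
  cases s with
  | zero => exact h.elim
  | tri α A β hα hβ hA =>
    obtain ⟨w, rfl, rfl, _⟩ := h
    simp [degree]

theorem Semi.exists_rel {s : Semi D} (h : s ≠ 0) : ∃ C ≠ ⊥, ∃ x y, Rel C s x y := by
  cases s with
  | zero => exact (h rfl).elim
  | tri α A β hα hβ hA => exact ⟨A, hA, α, β, [], by simp, by simp, le_rfl⟩

/-- A nonzero product relates some pair of words, and the length of the intermediate word cancels.
Zero products are excluded because `0` has the arbitrary degree `0`. -/
theorem Semi.degree_mul {s t : Semi D} (h : s * t ≠ 0) :
    (s * t).degree = s.degree + t.degree := by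
  obtain ⟨C, hC, x, y, hr⟩ := exists_rel h
  obtain ⟨z, h1, h2⟩ := (rel_mul s t hC x y).1 hr
  rw [degree_eq_of_rel hr, degree_eq_of_rel h1, degree_eq_of_rel h2]
  ring

theorem Semi.degree_star (s : Semi D) : (star s).degree = -s.degree := by
  cases s with
  | zero => rfl
  | tri α A β hα hβ hA =>
    change (β.length : ℤ) - α.length = -((α.length : ℤ) - β.length)
    ring

theorem Semi.degree_idem (e : Idem (Semi D)) : e.1.degree = 0 := by
  rcases bot_or_idem e with rfl | ⟨w, A, hw, hA, rfl⟩
  · rfl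
  · exact sub_self _

theorem ne_zero_of_dom {S : Type u} [InverseSemigroupWithZero S] {s : S} {φ : TightChar S}
    (h : φ.1 (dom s) = true) : s ≠ 0 := by
  rintro rfl
  have h1 : dom (0 : S) = ⊥ := Subtype.ext (mul_zero _)
  rw [h1, φ.2.map_bot] at h
  exact absurd h (by decide)

/-- Makes the degree a function of the germ: `s e` is nonzero because `φ` takes the value 1 on its
domain idempotent, so `degree_mul` applies to both sides. -/
theorem degree_eq_of_mul_idem {s t : Semi D} {φ : TightChar (Semi D)}
    (hs : φ.1 (dom s) = true) {e : Idem (Semi D)} (he : φ.1 e = true)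
    (h : s * e.1 = t * e.1) : s.degree = t.degree := by
  have h0 : s * e.1 ≠ 0 := by
    apply ne_zero_of_dom (φ := φ)
    have h1 : dom (s * e.1) = e ⊓ (dom s ⊓ e) := by
      apply Subtype.ext
      change star (s * e.1) * (s * e.1) = e.1 * ((star s * s) * e.1)
      rw [star_of_mul, star_idem e.2]
      simp only [mul_assoc]
    rw [h1, φ.2.map_inf, φ.2.map_inf, he, hs]
    rfl
  have h1 := degree_mul h0
  rw [h] at h0
  have h2 := degree_mul h0
  rw [degree_idem, add_zero] at h1 h2
  rw [← h1, ← h2, h]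

/-! ### The isomorphism -/

theorem mem_boundarySet (p : GermPair (Semi D)) :
    ((TightChar.act p.elt p.chr p.mem).toFilter, p.elt.degree, p.chr.toFilter) ∈
      D.boundarySet := by
  obtain ⟨s, φ, h⟩ := p
  cases s with
  | zero => exact absurd rfl (ne_zero_of_dom h)
  | tri β A γ hβ hγ hA =>
    obtain ⟨α', hw⟩ := exists_isWordOf_append h
    exact ⟨β, γ, α', isWordOf_act h hw, hw, rfl, cut_act_eq_cut h hw⟩

variable (D) in
/-- The map `[t, φ] ↦ (ρ_t(φ), deg t, φ)`. -/
noncomputable def boundaryMap (g : TightGroupoid (Semi D)) : D.BoundaryGroupoid :=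
  Quotient.lift (fun p : GermPair (Semi D) => (⟨_, mem_boundarySet p⟩ : D.BoundaryGroupoid))
    (by
      rintro ⟨s, φ, hs⟩ ⟨t, ψ, ht⟩ ⟨h, e, he, hst⟩
      obtain rfl : φ = ψ := h
      apply Subtype.ext
      exact Prod.ext (congrArg TightChar.toFilter (TightChar.act_congr hs ht e he hst))
        (Prod.ext (degree_eq_of_mul_idem hs he hst) rfl)) g

/-! ### Injectivity -/

/-- Below the idempotent `(γv, θ_v(A) ⊓ A', γv)`, which `slice_inf` places in the filter, both
elements send `γvw` to `βvw`. -/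
theorem germ_eq_of_isBeginning {β γ v : List L} {A A' : B}
    {hβ : A ∈ D.ideal β} {hγ : A ∈ D.ideal γ} {hA : A ≠ ⊥} {hβ' : A' ∈ D.ideal (β ++ v)}
    {hγ' : A' ∈ D.ideal (γ ++ v)} {hA' : A' ≠ ⊥} {φ : TightChar (Semi D)}
    (h : φ.1 (dom (tri β A γ hβ hγ hA)) = true)
    (h' : φ.1 (dom (tri (β ++ v) A' (γ ++ v) hβ' hγ' hA')) = true) :
    TightGroupoid.germ _ φ h = TightGroupoid.germ _ φ h' := by
  obtain ⟨h1, h2, h3⟩ := slice_inf φ.toFilter.2.1 (mem_slice_of_dom h) (mem_slice_of_dom h')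
  apply Quotient.sound
  refine ⟨rfl, _, h3, ?_⟩
  apply rel_ext
  intro C hC x y
  change Rel C (mul (tri β A γ hβ hγ hA) (idem _ _ h1 h2).1) x y ↔
    Rel C (mul (tri (β ++ v) A' (γ ++ v) hβ' hγ' hA') (idem _ _ h1 h2).1) x y
  rw [rel_mul _ _ hC, rel_mul _ _ hC]
  constructor
  · rintro ⟨z, ⟨w, rfl, rfl, h4⟩, w', h5, rfl, h6⟩
    rw [List.append_assoc] at h5
    obtain rfl := List.append_cancel_left h5
    refine ⟨(γ ++ v) ++ w', ⟨w', by simp, rfl, ?_⟩, w', rfl, rfl, h6⟩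
    exact h6.trans (D.act_mono w' inf_le_right)
  · rintro ⟨z, ⟨w, rfl, rfl, h4⟩, w', h5, rfl, h6⟩
    obtain rfl := List.append_cancel_left h5
    refine ⟨(γ ++ v) ++ w, ⟨v ++ w, by simp, by simp, ?_⟩, w, rfl, rfl, h6⟩
    rw [act_append]
    exact h6.trans (D.act_mono w inf_le_left)

theorem germ_eq_of_length_le {β γ β' γ' : List L} {A A' : B}
    {hβ : A ∈ D.ideal β} {hγ : A ∈ D.ideal γ} {hA : A ≠ ⊥} {hβ' : A' ∈ D.ideal β'}
    {hγ' : A' ∈ D.ideal γ'} {hA' : A' ≠ ⊥} {φ : TightChar (Semi D)}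
    (h : φ.1 (dom (tri β A γ hβ hγ hA)) = true)
    (h' : φ.1 (dom (tri β' A' γ' hβ' hγ' hA')) = true)
    (hact : TightChar.act _ φ h = TightChar.act _ φ h')
    (hdeg : (β.length : ℤ) - γ.length = (β'.length : ℤ) - γ'.length)
    (hl : γ.length ≤ γ'.length) :
    TightGroupoid.germ _ φ h = TightGroupoid.germ _ φ h' := by
  obtain ⟨v, rfl⟩ := slice_comparable φ.toFilter.2.1 ⟨A, mem_slice_of_dom h⟩
    ⟨A', mem_slice_of_dom h'⟩ hl
  have h1 := mem_slice_act h'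
  rw [← hact] at h1
  simp only [List.length_append, Nat.cast_add] at hdeg
  obtain ⟨v', rfl⟩ := slice_comparable (TightChar.act _ φ h).toFilter.2.1
    ⟨A, mem_slice_act h⟩ ⟨A', h1⟩ (by omega)
  obtain ⟨α', hw⟩ := exists_isWordOf_append h'
  have hw1 := isWordOf_act h' hw
  rw [Word.append_append] at hw hw1
  have hw2 := isWordOf_act h hw
  rw [hact] at hw2
  -- The word of the common range is both `βv'α'` and `βvα'`; equality of degrees gives `|v'| =
  -- |v|`.
  have h2 := Word.append_left_cancel (hw1.unique hw2)
  obtain rfl : v' = v := by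
    obtain ⟨u, hu, -⟩ := Word.append_eq_append h2
      (by simp only [List.length_append, Nat.cast_add] at hdeg; omega)
    have h3 : u = [] := by
      have := congrArg List.length hu
      simp only [List.length_append, Nat.cast_add] at this hdeg
      exact List.length_eq_zero_iff.1 (by omega)
    rw [hu, h3, List.append_nil]
  exact germ_eq_of_isBeginning h h'

theorem boundaryMap_injective : Function.Injective (boundaryMap D) := by
  rintro ⟨s, φ, hs⟩ ⟨t, ψ, ht⟩ heq
  have h1 := congrArg (fun z => z.1.1) heq
  have h2 := congrArg (fun z => z.1.2.1) heq
  have h3 := congrArg (fun z => z.1.2.2) heq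
  obtain rfl : φ = ψ := TightChar.toFilter_injective h3
  have hact : TightChar.act s φ hs = TightChar.act t φ ht := TightChar.toFilter_injective h1
  have hdeg : s.degree = t.degree := h2
  change TightGroupoid.germ s φ hs = TightGroupoid.germ t φ ht
  cases s with
  | zero => exact absurd rfl (ne_zero_of_dom hs)
  | tri β A γ hβ hγ hA =>
    cases t with
    | zero => exact absurd rfl (ne_zero_of_dom ht)
    | tri β' A' γ' hβ' hγ' hA' =>
      rcases le_total γ.length γ'.length with hl | hl
      · exact germ_eq_of_length_le hs ht hact hdeg hl
      · exact (germ_eq_of_length_le ht hs hact.symm hdeg.symm hl).symm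

/-! ### Surjectivity -/

/-- If two filters have the same cuts, then their slices at the removed words share an element. -/
theorem exists_mem_slice_of_cut_eq {η ξ : Set (Idem (Semi D))} (hη : IsPosetFilter η)
    (hξ : IsPosetFilter ξ) {α β : List L} {γ : Word L} (hwη : D.IsWordOf η (Word.append α γ))
    (hwξ : D.IsWordOf ξ (Word.append β γ)) (h : D.cut α γ η = D.cut β γ ξ)
    (hα : (D.slice η α).Nonempty) : ∃ A, A ∈ D.slice η α ∧ A ∈ D.slice ξ β := by
  obtain ⟨C, hC⟩ := hα
  have hb : Word.IsBeginning [] γ := ⟨γ, rfl⟩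
  have hnil : ∀ X : B, X ∈ D.ideal [] := Set.mem_univ
  have h1 := (mem_cut hη hwη [] C (hnil C) hC.2.1).2
    ⟨hb, C, by rwa [List.append_nil], le_rfl⟩
  rw [h, mem_cut hξ hwξ, List.append_nil] at h1
  obtain ⟨-, A, hA, hAC⟩ := h1
  -- `A ≤ C` only gives `A ∈ I_α`. Passing through the common cut a second time finds an element
  -- below `A` in the slice at `α`, so `A` is in that slice too.
  have h2 := (mem_cut hξ hwξ [] A (hnil A) hA.2.1).2
    ⟨hb, A, by rwa [List.append_nil], le_rfl⟩
  rw [← h, mem_cut hη hwη, List.append_nil] at h2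
  obtain ⟨-, A', hA', hle⟩ := h2
  exact ⟨A, slice_mono hη hA' (D.ideal_lower hAC hC.1) hle, hA⟩

theorem slice_nonempty_of_ne_nil {ξ : Set (Idem (Semi D))} (hξ : IsPosetFilter ξ) {α : List L}
    {γ : Word L} (hw : D.IsWordOf ξ (Word.append α γ)) (hα : α ≠ []) :
    (D.slice ξ α).Nonempty := by
  have hb : Word.IsBeginning α (Word.append α γ) := ⟨γ, rfl⟩
  obtain ⟨w, hwl, hne⟩ := hw.cofinal α.length hb.le_length
  obtain ⟨v, rfl⟩ := hb.exists_append (hw.isBeginning w hne) hwl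
  exact slice_prefix_nonempty hξ hα hne

theorem boundaryMap_surjective : Function.Surjective (boundaryMap D) := by
  rintro ⟨⟨η, n, ξ⟩, α, β, γ, hη, hξ, hn, hc⟩
  obtain ⟨φ, rfl⟩ := TightChar.toFilter_surjective ξ
  obtain ⟨ψ, rfl⟩ := TightChar.toFilter_surjective η
  change D.IsWordOf ψ.toFilter.1 (Word.append α γ) at hη
  change D.IsWordOf φ.toFilter.1 (Word.append β γ) at hξ
  change n = _ at hn
  change D.cut α γ ψ.toFilter.1 = D.cut β γ φ.toFilter.1 at hc
  have hfη := ψ.toFilter.2.1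
  have hfξ := φ.toFilter.2.1
  suffices hex : ∃ s, ∃ h : φ.1 (dom s) = true, TightChar.act s φ h = ψ ∧ s.degree = n by
    obtain ⟨s, h, h1, h2⟩ := hex
    refine ⟨TightGroupoid.germ s φ h, Subtype.ext ?_⟩
    exact Prod.ext (congrArg TightChar.toFilter h1) (Prod.ext h2 rfl)
  -- When both words are empty, the slices at the empty word may be empty, so an arbitrary
  -- idempotent of the filter represents the unit germ instead.
  by_cases hnil : α = [] ∧ β = []
  · obtain ⟨rfl, rfl⟩ := hnil
    obtain rfl : ψ = φ := TightChar.toFilter_injective (Subtype.ext hc)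
    obtain ⟨w, A, hA⟩ := exists_slice_nonempty hfξ
    have h := dom_of_mem_slice (hγ := hA.1) (hA := hA.2.1) hA.1 hA
    exact ⟨_, h, act_tri_self h, by rw [hn, degree]; simp⟩
  · obtain ⟨A, hAη, hAξ⟩ : ∃ A, A ∈ D.slice ψ.toFilter.1 α ∧ A ∈ D.slice φ.toFilter.1 β := by
      by_cases hα : α = []
      · have hβ : β ≠ [] := fun h0 => hnil ⟨hα, h0⟩
        obtain ⟨A, h1, h2⟩ := exists_mem_slice_of_cut_eq hfξ hfη hξ hη hc.symm
          (slice_nonempty_of_ne_nil hfξ hξ hβ)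
        exact ⟨A, h2, h1⟩
      · exact exists_mem_slice_of_cut_eq hfη hfξ hη hξ hc (slice_nonempty_of_ne_nil hfη hη hα)
    have hA := hAη.2.1
    have h₀ : A ∈ D.ideal [] := Set.mem_univ A
    have h := dom_of_mem_slice (hγ := hAξ.1) (hA := hA) hAη.1 hAξ
    have h1 := dom_of_mem_slice (hγ := hAξ.1) (hA := hA) h₀ hAξ
    have h2 := dom_of_mem_slice (hγ := hAη.1) (hA := hA) h₀ hAη
    have h3 := dom_of_mem_slice (hγ := hAη.1) (hA := hA) hAη.1 hAη
    have h4 := dom_act_tri hAη.1 h1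
    have h5 := dom_act_tri hAη.1 h2
    refine ⟨_, h, ?_, hn.symm⟩
    have key : TightChar.act _ φ h1 = TightChar.act _ ψ h2 := by
      apply TightChar.toFilter_injective
      apply Subtype.ext
      rw [toFilter_act_eq_cut h1 hξ, toFilter_act_eq_cut h2 hη, hc]
    -- `(α, A, β)φ = (α, A, ∅)(∅, A, β)φ` and `ψ = (α, A, α)ψ = (α, A, ∅)(∅, A, α)ψ`; the inner
    -- characters agree by `key`.
    rw [← act_act_tri h1 h4 h, ← act_tri_self h3, ← act_act_tri h2 h5 h3]
    congr 1

/-! ### The isomorphism and its formula -/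

theorem boundaryMap_isGroupoidIso : IsGroupoidIso (boundaryMap D) where
  bijective := ⟨boundaryMap_injective, boundaryMap_surjective⟩
  composable_iff := by
    rintro ⟨p⟩ ⟨q⟩
    exact TightChar.toFilter_injective.eq_iff.symm
  map_comp := by
    rintro ⟨s, φ, hs⟩ ⟨t, ψ, ht⟩ h
    have h' : φ = TightChar.act t ψ ht := h
    subst h'
    have hm := TightGroupoid.mul_mem (p := ⟨s, _, hs⟩) (q := ⟨t, ψ, ht⟩) rfl
    apply Subtype.ext
    exact Prod.ext (congrArg TightChar.toFilter (TightGroupoid.act_act s t ψ ht hs hm))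
      (Prod.ext (degree_mul (ne_zero_of_dom hm)) rfl)
  map_inv := by
    rintro ⟨s, φ, hs⟩
    apply Subtype.ext
    exact Prod.ext (congrArg TightChar.toFilter (TightGroupoid.act_star_act s φ hs _))
      (Prod.ext (degree_star s) rfl)

end GBDS

theorem theorem5 {B : Type u} [GeneralizedBooleanAlgebra B] {L : Type v} (D : GBDS B L) :
    ∃ Φ : TightGroupoid (GBDS.Semi D) → D.BoundaryGroupoid,
      IsGroupoidIso Φ ∧
      ∀ (β : List L) (A : B) (γ : List L) (hβ : A ∈ D.ideal β) (hγ : A ∈ D.ideal γ) (hA : A ≠ ⊥)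
        (φ : TightChar (GBDS.Semi D)) (hφ : φ.1 (Idem.dom (GBDS.Semi.tri β A γ hβ hγ hA)) = true),
        (∃ α' ∈ D.words, φ.toFilter ∈ D.tightAt (Word.append γ α')) ∧
        ∀ α' : Word L, φ.toFilter ∈ D.tightAt (Word.append γ α') →
          ∃ ζ ∈ D.tightGlueable γ α' ∩ D.tightGlueable β α',
            ζ.1 = D.cut γ α' φ.toFilter.1 ∧
            ∃ η ∈ D.tightAt (Word.append β α'),
              η.1 = D.glue β α' ζ.1 ∧
              (Φ (TightGroupoid.germ (GBDS.Semi.tri β A γ hβ hγ hA) φ hφ)).1 =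
                (η, (β.length : ℤ) - (γ.length : ℤ), φ.toFilter) := by
  refine ⟨GBDS.boundaryMap D, GBDS.boundaryMap_isGroupoidIso, ?_⟩
  intro β A γ hβ hγ hA φ hφ
  have h₀ : A ∈ D.ideal [] := Set.mem_univ A
  have h1 := GBDS.dom_of_mem_slice (hγ := hγ) (hA := hA) h₀ (GBDS.mem_slice_of_dom hφ)
  have h2 := GBDS.dom_act_tri hβ h1
  have hword : ∀ {α' : Word L}, D.IsWordOf φ.toFilter.1 (Word.append γ α') →
      D.IsWordOf (TightChar.act _ φ h1).toFilter.1 α' := fun hw => GBDS.isWordOf_act h1 hw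
  refine ⟨?_, ?_⟩
  · obtain ⟨α', hw⟩ := GBDS.exists_isWordOf_append hφ
    exact ⟨α', (hword hw).mem_words, hw⟩
  · intro α' hw
    have hA0 := GBDS.mem_slice_act h1
    -- The cut filter is that of `(∅, A, γ)φ`. Its slice at the empty word contains `A`, which lies
    -- in `I_γ` and in `I_β`, so both gluing conditions hold.
    refine ⟨(TightChar.act _ φ h1).toFilter,
      ⟨⟨hword hw, fun _ => ⟨A, hA0, hγ⟩⟩, ⟨hword hw, fun _ => ⟨A, hA0, hβ⟩⟩⟩,
      GBDS.toFilter_act_eq_cut h1 hw, (TightChar.act _ φ hφ).toFilter,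
      GBDS.isWordOf_act hφ hw, ?_, rfl⟩
    rw [← GBDS.act_act_tri h1 h2 hφ]
    exact GBDS.toFilter_act_eq_glue h2 (hword hw)
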